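/- **Conventions.** Let $M$ be a compact Hausdorff space. A (smooth, $n$-dimensional) orbifold chart of $M$ is a triple $(U,\varphi,\widehat U/\Gamma)$ of an open set $U\subseteq M$, an open set $\widehat U\subseteq\mathbb R^n$ with a finite group $\Gamma$ of $C^\infty$-diffeomorphisms of $\widehat U$, and a homeomorphism $\varphi:U\to\widehat U/\Gamma$; here $\Gamma$ acts effectively, in the sense that no non-trivial element of $\Gamma$ is the identity on a non-empty open subset of $\widehat U$ (this is automatic if $\widehat U$ is connected). Let $\pi_\Gamma:\widehat U\to\widehat U/\Gamma$ be the orbit map and $p:=\varphi^{-1}\circ\pi_\Gamma:\widehat U\to M$. An orbifold atlas is a family of orbifold charts whose domains cover $M$ and such that, for any two charts $\lambda,\mu$ of the family and any $x\in U_\lambda\cap U_\mu$, there are an orbifold chart $(W,\psi,\widehat W/\Gamma')$ with $x\in W$ and smooth embeddings $\rho_\lambda:\widehat W\to\widehat U_\lambda$, $\rho_\mu:\widehat W\to\widehat U_\mu$ with $p_\lambda\circ\rho_\lambda=\psi^{-1}\circ\pi_{\Gamma'}=p_\mu\circ\rho_\mu$. A transition from $\lambda$ to $\mu$ is a smooth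 diffeomorphism $\eta$ of an open subset of $\widehat U_\lambda$ onto an open subset of $\widehat U_\mu$ with $p_\mu\circ\eta=p_\lambda$. The singular set $\Sigma$ consists of the points $p_\lambda(y)$, $y\in\widehat U_\lambda$, with non-trivial stabilizer $(\Gamma_\lambda)_y$. The orbitangent bundle $TM$ is the set of all triples $(\lambda,y,v)$, where $\lambda$ is a chart of the atlas, $y\in\widehat U_\lambda$ and $v\in T_y\widehat U_\lambda=\mathbb R^n$, modulo the equivalence relation generated by $(\lambda,y,v)\sim(\mu,\eta(y),d\eta_y(v))$ for all transitions $\eta$ from $\lambda$ to $\mu$; it projects to $M$ by $[\lambda,y,v]\mapsto p_\lambda(y)$. A $C^1$-orbitangent vector field is a section $X:M\to TM$ that has over each chart $\lambda$ of the atlas a local lift, i.e. a $C^1$ vector field $\widehat X_\lambda$ on $\widehat U_\lambda$ with $X(p_\lambda(y))=[\lambda,y,\widehat X_\lambda(y)]$ for all $y\in\widehat U_\lambda$. A $C^k$-Riemannian orbimetric $g$ is a family of $C^k$ Riemannian metrics $\widehat g_\lambda$ on the sets $\widehat U_\lambda$ that is preserved by all transitions. The divergence of $X$ is the function on $M$ given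 by $(\operatorname{div}_gX)(p_\lambda(y))=(\operatorname{div}_{\widehat g_\lambda}\widehat X_\lambda)(y)$, the trace of the Levi-Civita covariant derivative of $\widehat X_\lambda$. The volume measure $dv_g$ is that of the Riemannian manifold $M\setminus\Sigma$, and $\int_M\rho\,dv_g:=\int_{M\setminus\Sigma}\rho\,dv_g$. **Theorem 6.1.** Let $M$ be a compact smooth orbifold with a $C^k$-Riemannian orbimetric $g$, where $1\le k\le\infty$, and let $X$ be a $C^1$-orbitangent vector field on $M$. Then $\operatorname{div}_gX$ is integrable over $M$ and $$\int_M \operatorname{div}_g X\,dv_g=0 .$$ -/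

import Mathlib

open MeasureTheory Set TopologicalSpace
open scoped ContDiff

noncomputable section

namespace Orbi

/-- The model space `ℝⁿ`, with its Euclidean norm and Lebesgue measure. -/
abbrev E (n : ℕ) : Type := EuclideanSpace ℝ (Fin n)

/-- The `i`-th standard basis vector of `ℝⁿ`. -/
def basisVec {n : ℕ} (i : Fin n) : E n := EuclideanSpace.single i 1

/-- The partial derivative `∂ᵢ f` of a real function on `ℝⁿ`. -/
def partialDeriv {n : ℕ} (i : Fin n) (f : E n → ℝ) (x : E n) : ℝ := fderiv ℝ f x (basisVec i)

/-! ### Orbifolds -/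

/-- An `n`-dimensional smooth orbifold chart `(U, φ, Û/Γ)` of a space `M`: an open set `U` of `M`,
an open set `Û` of `ℝⁿ`, a finite group `Γ` of diffeomorphisms of `Û` and a homeomorphism
`φ : U → Û/Γ`. The group acts effectively, in the sense that only the identity of `Γ` can be the
identity map on some nonempty open subset of `Û`; if `Û` is connected, then every finite group of
diffeomorphisms of `Û` has this property. -/
structure OrbifoldChart (n : ℕ) (M : Type*) [TopologicalSpace M] where
  /-- the domain of the chart -/
  U : Opens M
  /-- the open subset `Û` of `ℝⁿ` -/
  Uhat : Opens (E n)
  /-- the group `Γ` -/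
  Γ : Subgroup (Equiv.Perm Uhat)
  finite_Γ : Finite Γ
  /-- The elements of `Γ` are smooth (so are then their inverses, which are elements of `Γ`). -/
  smooth_Γ : ∀ γ ∈ Γ, ∃ f : E n → E n, ContDiffOn ℝ ∞ f Uhat ∧ ∀ x : Uhat, f x = (γ x : E n)
  effective : ∀ γ ∈ Γ, ∀ V : Set Uhat, IsOpen V → V.Nonempty → (∀ x ∈ V, γ x = x) → γ = 1
  /-- the homeomorphism of `U` onto the orbit space (with the quotient topology) -/
  φ : U ≃ₜ Quotient (MulAction.orbitRel Γ Uhat)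

variable {n : ℕ} {M : Type*} [TopologicalSpace M]

/-- The map `φ⁻¹ ∘ π_Γ : Û → M` of an orbifold chart. -/
def OrbifoldChart.proj (c : OrbifoldChart n M) (x : c.Uhat) : M :=
  (c.φ.symm (Quotient.mk (MulAction.orbitRel c.Γ c.Uhat) x) : M)

/-- `η` is a smooth diffeomorphism from an open subset of `Û_c` onto an open subset of `Û_d`
with `φ_d⁻¹ ∘ π_d ∘ η = φ_c⁻¹ ∘ π_c` on its domain. -/
structure IsTransition (c d : OrbifoldChart n M) (η : OpenPartialHomeomorph (E n) (E n)) :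
    Prop where
  source_subset : η.source ⊆ c.Uhat
  target_subset : η.target ⊆ d.Uhat
  contDiffOn : ContDiffOn ℝ ∞ η η.source
  contDiffOn_symm : ContDiffOn ℝ ∞ η.symm η.target
  proj_eq : ∀ (x : E n) (hx : x ∈ η.source),
    d.proj ⟨η x, target_subset (η.map_source hx)⟩ = c.proj ⟨x, source_subset hx⟩

/-- An `n`-dimensional smooth orbifold atlas on `M`: a family of orbifold charts whose domains
cover `M` and such that for any two charts `c`, `d` of the family, each point of `U_c ∩ U_d` lies
in the domain of an orbifold chart `w` for which there are smooth embeddings `Û_w → Û_c` and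
`Û_w → Û_d` over the identity of `M` (an embedding between open subsets of `ℝⁿ` is the same as a
diffeomorphism onto an open subset). -/
structure Orbifold (n : ℕ) (M : Type*) [TopologicalSpace M] where
  charts : Set (OrbifoldChart n M)
  cover : ∀ x : M, ∃ c ∈ charts, x ∈ c.U
  compat : ∀ c ∈ charts, ∀ d ∈ charts, ∀ x : M, x ∈ c.U → x ∈ d.U →
    ∃ w : OrbifoldChart n M, x ∈ w.U ∧
      (∃ ρ, IsTransition w c ρ ∧ ρ.source = w.Uhat) ∧
      (∃ ρ, IsTransition w d ρ ∧ ρ.source = w.Uhat)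

namespace Orbifold

theorem exists_proj_eq (O : Orbifold n M) (x : M) :
    ∃ p : (c : O.charts) × c.1.Uhat, p.1.1.proj p.2 = x := by
  obtain ⟨c, hc, hx⟩ := O.cover x
  obtain ⟨y, hy⟩ := Quotient.exists_rep (c.φ ⟨x, hx⟩)
  refine ⟨⟨⟨c, hc⟩, y⟩, ?_⟩
  simp [OrbifoldChart.proj, hy]

/-- The singular set: the points of `M` at which the local group is not trivial. The local group
at `φ⁻¹(π_Γ(y))` is the stabilizer of `y` in `Γ`. -/
def singularSet (O : Orbifold n M) : Set M :=
  {x | ∃ c ∈ O.charts, ∃ y : c.Uhat, c.proj y = x ∧ MulAction.stabilizer c.Γ y ≠ ⊥}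

/-! ### The orbitangent bundle and orbitangent vector fields -/

/-- A tangent vector `v ∈ T_y Û` upstairs in some chart of the atlas. -/
structure LocalVector (O : Orbifold n M) where
  chart : O.charts
  pt : chart.1.Uhat
  vec : E n

/-- Two tangent vectors upstairs are related if some local diffeomorphism `η` over the identity of
`M` carries the one to the other by its differential. As `η` may be an element of `Γ`, this
relation contains the action of the local groups on the tangent spaces. -/
def LocalVector.Rel {O : Orbifold n M} (p q : O.LocalVector) : Prop :=
  ∃ η, IsTransition p.chart.1 q.chart.1 η ∧ (p.pt : E n) ∈ η.source ∧ η p.pt = q.pt ∧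
    fderiv ℝ η p.pt p.vec = q.vec

/-- The orbitangent bundle `TM`. Its fibre over `x` is the orbitangent space at `x`. -/
def TangentBundle (O : Orbifold n M) : Type _ := Quot (LocalVector.Rel (O := O))

/-- The class in `TM` of a tangent vector upstairs. -/
def TangentBundle.mk {O : Orbifold n M} (c : O.charts) (y : c.1.Uhat) (v : E n) :
    O.TangentBundle :=
  Quot.mk _ ⟨c, y, v⟩

/-- The projection `TM → M`. -/
def TangentBundle.pr {O : Orbifold n M} : O.TangentBundle → M :=
  Quot.lift (fun p => p.chart.1.proj p.pt) (by
    rintro ⟨c, y, v⟩ ⟨d, z, w⟩ ⟨η, hη, hy, hz, -⟩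
    have h := hη.proj_eq y hy
    have e : (⟨η y, hη.target_subset (η.map_source hy)⟩ : d.1.Uhat) = z := Subtype.ext hz
    simp only at h ⊢
    rw [← h, ← e])

/-- A `C^k` orbitangent vector field: a section `X` of `TM → M` that has, over each chart
`(U, φ, Û/Γ)` of the atlas, a local lift, that is, a `C^k` vector field on `Û` whose value at
each `y ∈ Û` represents the value of `X` at `φ⁻¹(π_Γ(y))`. -/
structure VectorField (O : Orbifold n M) (k : ℕ∞) where
  toFun : M → O.TangentBundle
  pr_toFun : ∀ x, (toFun x).pr = x
  exists_lift : ∀ c : O.charts, ∃ V : E n → E n, ContDiffOn ℝ k V c.1.Uhat ∧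
    ∀ y : c.1.Uhat, toFun (c.1.proj y) = TangentBundle.mk c y (V y)

/-- The local lift of an orbitangent vector field over a chart. (It is unique on `Û`: points with
trivial stabilizer are dense there. Its values off `Û` play no role.) -/
def VectorField.lift {O : Orbifold n M} {k : ℕ∞} (X : O.VectorField k) (c : O.charts) :
    E n → E n :=
  (X.exists_lift c).choose

/-! ### Riemannian orbimetrics -/

/-- A `C^k` Riemannian orbimetric: a positive definite symmetric `(0,2)`-orbitensor field of class
`C^k`. It is given by its local lifts, which are `C^k` Riemannian metrics on the sets `Û`; every
local diffeomorphism over the identity of `M`, in particular every element of a group `Γ`,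
preserves them. -/
structure RiemannianMetric (O : Orbifold n M) (k : ℕ∞) where
  lift : O.charts → E n → E n →L[ℝ] E n →L[ℝ] ℝ
  contDiffOn : ∀ c, ContDiffOn ℝ k (lift c) c.1.Uhat
  symm : ∀ c, ∀ x ∈ c.1.Uhat, ∀ v w, lift c x v w = lift c x w v
  pos : ∀ c, ∀ x ∈ c.1.Uhat, ∀ v, v ≠ 0 → 0 < lift c x v v
  compat : ∀ (c d : O.charts) (η), IsTransition c.1 d.1 η → ∀ x ∈ η.source, ∀ v w,
    lift d (η x) (fderiv ℝ η x v) (fderiv ℝ η x w) = lift c x v w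

end Orbifold

/-! ### Metric and divergence in coordinates -/

/-- The matrix `(g_ij)` of a metric on an open set of `ℝⁿ`. -/
def metricMatrix (g : E n → E n →L[ℝ] E n →L[ℝ] ℝ) (x : E n) : Matrix (Fin n) (Fin n) ℝ :=
  Matrix.of fun i j => g x (basisVec i) (basisVec j)

/-- The Christoffel symbol `Γ^k_ij` of the Levi-Civita connection of `g`. -/
def christoffel (g : E n → E n →L[ℝ] E n →L[ℝ] ℝ) (x : E n) (k i j : Fin n) : ℝ :=
  (1 / 2) * ∑ l, (metricMatrix g x)⁻¹ k l *
    (partialDeriv i (fun y => metricMatrix g y j l) x +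
     partialDeriv j (fun y => metricMatrix g y i l) x -
     partialDeriv l (fun y => metricMatrix g y i j) x)

/-- The component `(∇_i V)^k` of the covariant derivative of the vector field `V`. -/
def covDeriv (g : E n → E n →L[ℝ] E n →L[ℝ] ℝ) (V : E n → E n) (x : E n) (i k : Fin n) : ℝ :=
  partialDeriv i (fun y => V y k) x + ∑ j, christoffel g x k i j * V x j

/-- The divergence of `V` with respect to `g`: the trace of `∇V`. -/
def localDiv (g : E n → E n →L[ℝ] E n →L[ℝ] ℝ) (V : E n → E n) (x : E n) : ℝ :=
  ∑ i, covDeriv g V x i i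

namespace Orbifold

/-- The divergence of an orbitangent vector field: at `x = φ⁻¹(π_Γ(y))` it is the divergence at
`y` of the local lift of `X` with respect to the local lift of `g`. -/
def div {O : Orbifold n M} {k l : ℕ∞} (g : O.RiemannianMetric k) (X : O.VectorField l) (x : M) :
    ℝ :=
  let p := (O.exists_proj_eq x).choose
  localDiv (g.lift p.1) (X.lift p.1) p.2

/-- For `V ⊆ Û`, the image in `M` of the measure `√det(g_ij) dx` on `V`. -/
def RiemannianMetric.patchMeasure [MeasurableSpace M] {O : Orbifold n M} {k : ℕ∞}
    (g : O.RiemannianMetric k) (c : O.charts) (V : Set c.1.Uhat) : Measure M :=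
  ((((volume : Measure (E n)).comap Subtype.val).restrict V).withDensity fun y =>
    ENNReal.ofReal (Real.sqrt (metricMatrix (g.lift c) y).det)).map c.1.proj

/-- The Riemannian volume measure `dv_g` of the Riemannian manifold `M ∖ Σ`, `Σ` the singular set,
as a measure on `M`. The open sets `V ⊆ Û` on which `φ⁻¹ ∘ π_Γ` is injective are the
coordinate patches of this manifold, and `dv_g` is the least measure that is at least
`√det(g_ij) dx` on each of them; as these local measures agree on overlaps, it is equal to
`√det(g_ij) dx` there. -/
def RiemannianMetric.vol [MeasurableSpace M] {O : Orbifold n M} {k : ℕ∞}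
    (g : O.RiemannianMetric k) : Measure M :=
  ⨆ (c : O.charts) (V : Set c.1.Uhat) (_ : IsOpen V ∧ InjOn c.1.proj V), g.patchMeasure c V

end Orbifold

end Orbi

end

open scoped Topology

namespace Orbi

/-! ### Orbifold charts -/

namespace OrbifoldChart

variable {n : ℕ} {M : Type*} [TopologicalSpace M] (c : OrbifoldChart n M)

instance : Finite c.Γ := c.finite_Γ

theorem continuous_perm {γ : Equiv.Perm c.Uhat} (hγ : γ ∈ c.Γ) : Continuous γ := by
  obtain ⟨f, hf, h⟩ := c.smooth_Γ γ hγ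
  refine continuous_induced_rng.2 ((continuousOn_iff_continuous_domRestrict.1
    hf.continuousOn).congr fun x => ?_)
  exact h x

instance : ContinuousConstSMul c.Γ c.Uhat where
  continuous_const_smul γ := c.continuous_perm γ.2

theorem proj_mem (y : c.Uhat) : c.proj y ∈ c.U := Subtype.property _

theorem exists_proj_eq {x : M} (hx : x ∈ c.U) : ∃ y, c.proj y = x := by
  obtain ⟨y, hy⟩ := Quotient.exists_rep (c.φ ⟨x, hx⟩)
  exact ⟨y, by simp [OrbifoldChart.proj, hy]⟩

theorem range_proj : range c.proj = c.U :=
  Subset.antisymm (range_subset_iff.2 c.proj_mem) fun _ hx => c.exists_proj_eq hx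

theorem proj_eq_iff {y z : c.Uhat} : c.proj y = c.proj z ↔ ∃ γ : c.Γ, γ • z = y := by
  unfold OrbifoldChart.proj
  rw [Subtype.coe_inj, c.φ.symm.injective.eq_iff, Quotient.eq, MulAction.orbitRel_apply]
  rfl

theorem proj_smul (γ : c.Γ) (y : c.Uhat) : c.proj (γ • y) = c.proj y :=
  c.proj_eq_iff.2 ⟨γ, rfl⟩

theorem continuous_proj : Continuous c.proj :=
  continuous_subtype_val.comp (c.φ.symm.continuous.comp continuous_quotient_mk')

theorem isOpenMap_proj : IsOpenMap c.proj :=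
  (c.U.isOpen.isOpenEmbedding_subtypeVal.isOpenMap.comp c.φ.symm.isOpenMap).comp
    isOpenMap_quotient_mk'_mul

/-- The points of `Û` with trivial stabilizer. -/
def free : Set c.Uhat := {y | ∀ γ : c.Γ, γ • y = y → γ = 1}

theorem mem_free_iff {y : c.Uhat} : y ∈ c.free ↔ MulAction.stabilizer c.Γ y = ⊥ := by
  rw [Subgroup.eq_bot_iff_forall]
  rfl

theorem isOpen_free : IsOpen c.free := by
  have : c.free = ⋂ γ : c.Γ, {y | γ • y = y → γ = 1} := by
    ext y; simp [free]
  rw [this]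
  refine isOpen_iInter_of_finite fun γ => ?_
  by_cases h : γ = 1
  · simp [h]
  · simp only [h, imp_false]
    exact isOpen_ne_fun (continuous_const_smul γ) continuous_id

/-- A free point has a neighbourhood that meets none of its translates. -/
theorem exists_isOpen_disjoint {y : c.Uhat} (hy : y ∈ c.free) :
    ∃ V : Set c.Uhat, IsOpen V ∧ y ∈ V ∧ ∀ z ∈ V, ∀ γ : c.Γ, γ • z ∈ V → γ = 1 := by
  have key : ∀ γ : c.Γ, ∃ V : Set c.Uhat, IsOpen V ∧ y ∈ V ∧ ∀ z ∈ V, γ • z ∈ V → γ = 1 := by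
    intro γ
    by_cases h : γ = 1
    · exact ⟨univ, isOpen_univ, trivial, fun _ _ _ => h⟩
    · have hne : γ • y ≠ y := fun h' => h (hy γ h')
      obtain ⟨A, B, hA, hB, hyA, hyB, hAB⟩ := t2_separation hne
      refine ⟨B ∩ (fun z => γ • z) ⁻¹' A, hB.inter (hA.preimage (continuous_const_smul γ)),
        ⟨hyB, hyA⟩, fun z hz hz' => ?_⟩
      exact absurd hz'.1 (hAB.notMem_of_mem_left hz.2)
  choose V hV hyV h using key
  exact ⟨⋂ γ, V γ, isOpen_iInter_of_finite hV, mem_iInter.2 hyV,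
    fun z hz γ hγ => h γ z (mem_iInter.1 hz γ) (mem_iInter.1 hγ γ)⟩

end OrbifoldChart

/-! ### Transitions -/

section Transition

variable {n : ℕ} {M : Type*} [TopologicalSpace M] {c d e : OrbifoldChart n M}
  {η η' : OpenPartialHomeomorph (E n) (E n)}

theorem IsTransition.symm (h : IsTransition c d η) : IsTransition d c η.symm where
  source_subset := h.target_subset
  target_subset := h.source_subset
  contDiffOn := h.contDiffOn_symm
  contDiffOn_symm := by simpa using h.contDiffOn
  proj_eq x hx := by
    have := h.proj_eq (η.symm x) (η.map_target hx)
    rw [← this]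
    congr 2
    exact η.right_inv hx

theorem IsTransition.trans (h : IsTransition c d η) (h' : IsTransition d e η') :
    IsTransition c e (η.trans η') where
  source_subset x hx := by
    rw [OpenPartialHomeomorph.trans_source] at hx
    exact h.source_subset hx.1
  target_subset x hx := by
    rw [OpenPartialHomeomorph.trans_target] at hx
    exact h'.target_subset hx.1
  contDiffOn := by
    rw [OpenPartialHomeomorph.trans_source]
    exact h'.contDiffOn.comp (h.contDiffOn.mono inter_subset_left) fun x hx => hx.2
  contDiffOn_symm := by
    rw [OpenPartialHomeomorph.trans_target]
    exact h.contDiffOn_symm.comp (h'.contDiffOn_symm.mono inter_subset_left) fun x hx => hx.2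
  proj_eq x hx := by
    have hx' := hx
    rw [OpenPartialHomeomorph.trans_source] at hx'
    exact (h'.proj_eq (η x) hx'.2).trans (h.proj_eq x hx'.1)

/-- An element of `Γ` is a transition. -/
theorem exists_isTransition_smul (c : OrbifoldChart n M) (γ : c.Γ) :
    ∃ η, IsTransition c c η ∧ η.source = c.Uhat ∧ ∀ y : c.Uhat, η y = (γ • y : c.Uhat) := by
  obtain ⟨f, hf, hfγ⟩ := c.smooth_Γ γ γ.2
  obtain ⟨f', hf', hfγ'⟩ := c.smooth_Γ (γ⁻¹ : c.Γ) (γ⁻¹ : c.Γ).2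
  have h1 : ∀ y : c.Uhat, f y = (γ • y : c.Uhat) := hfγ
  have h2 : ∀ y : c.Uhat, f' y = (γ⁻¹ • y : c.Uhat) := hfγ'
  let η : OpenPartialHomeomorph (E n) (E n) :=
    { toFun := f
      invFun := f'
      source := c.Uhat
      target := c.Uhat
      map_source' := fun x hx => by rw [h1 ⟨x, hx⟩]; exact Subtype.property _
      map_target' := fun x hx => by rw [h2 ⟨x, hx⟩]; exact Subtype.property _
      left_inv' := fun x hx => by rw [h1 ⟨x, hx⟩, h2, inv_smul_smul]
      right_inv' := fun x hx => by rw [h2 ⟨x, hx⟩, h1, smul_inv_smul]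
      open_source := c.Uhat.isOpen
      open_target := c.Uhat.isOpen
      continuousOn_toFun := hf.continuousOn
      continuousOn_invFun := hf'.continuousOn }
  refine ⟨η, ⟨subset_rfl, subset_rfl, hf, hf', fun x hx => ?_⟩, rfl, h1⟩
  rw [← c.proj_smul γ ⟨x, hx⟩]
  congr 1
  exact Subtype.ext (h1 ⟨x, hx⟩)

/-- A transition from a chart to itself is the identity near each free fixed point. -/
theorem IsTransition.eventually_eq_self (h : IsTransition c c η) {y : c.Uhat} (hy : y ∈ c.free)
    (hys : (y : E n) ∈ η.source) (hfix : η y = y) : ∀ᶠ x in 𝓝 (y : E n), η x = x := by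
  obtain ⟨V, hV, hyV, hd⟩ := c.exists_isOpen_disjoint hy
  have hV' : IsOpen (Subtype.val '' V) := c.Uhat.isOpen.isOpenEmbedding_subtypeVal.isOpenMap V hV
  have hn : Subtype.val '' V ∈ 𝓝 (y : E n) := hV'.mem_nhds ⟨y, hyV, rfl⟩
  have hn2 : ∀ᶠ x in 𝓝 (y : E n), η x ∈ Subtype.val '' V :=
    (η.continuousAt hys).eventually (by rw [hfix]; exact hn)
  filter_upwards [hn, hn2, η.open_source.mem_nhds hys] with x hx hx2 hxs
  obtain ⟨z, hz, rfl⟩ := hx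
  obtain ⟨w, hw, hwz⟩ := hx2
  have hp := h.proj_eq z hxs
  obtain ⟨γ, hγ⟩ := c.proj_eq_iff.1 hp
  have hw' : γ • z = w := by
    rw [show z = ⟨z, h.source_subset hxs⟩ from rfl, hγ]
    exact Subtype.ext hwz.symm
  have := hd z hz γ (hw' ▸ hw)
  rw [this, one_smul] at hw'
  rw [← hwz, hw']

/-- The germ of a transition at a free point is determined by its value. -/
theorem IsTransition.eventuallyEq (h : IsTransition c d η) (h' : IsTransition c d η')
    {y : c.Uhat} (hy : y ∈ c.free) (hys : (y : E n) ∈ η.source) (hys' : (y : E n) ∈ η'.source)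
    (heq : η y = η' y) : η =ᶠ[𝓝 (y : E n)] η' := by
  have hτ := h.trans h'.symm
  have hmem : (y : E n) ∈ (η.trans η'.symm).source := by
    rw [OpenPartialHomeomorph.trans_source]
    refine ⟨hys, ?_⟩
    change η y ∈ η'.target
    rw [heq]
    exact η'.map_source hys'
  have := hτ.eventually_eq_self hy hmem (by
    change η'.symm (η y) = y
    rw [heq]
    exact η'.left_inv hys')
  filter_upwards [this, (η.trans η'.symm).open_source.mem_nhds hmem] with x hx hxs
  rw [OpenPartialHomeomorph.trans_source] at hxs
  have hx' : η'.symm (η x) = x := hx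
  rw [← η'.right_inv hxs.2, hx']

theorem IsTransition.contDiffAt (h : IsTransition c d η) {x : E n} (hx : x ∈ η.source) :
    ContDiffAt ℝ ∞ η x :=
  h.contDiffOn.contDiffAt (η.open_source.mem_nhds hx)

end Transition

namespace Orbifold

variable {n : ℕ} {M : Type*} [TopologicalSpace M] (O : Orbifold n M)

theorem exists_isTransition {c d : OrbifoldChart n M} (hc : c ∈ O.charts) (hd : d ∈ O.charts)
    {y : c.Uhat} {z : d.Uhat} (h : c.proj y = d.proj z) :
    ∃ η, IsTransition c d η ∧ (y : E n) ∈ η.source ∧ η y = z := by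
  obtain ⟨w, hxw, ⟨ρ, hρ, hρs⟩, ⟨σ, hσ, hσs⟩⟩ :=
    O.compat c hc d hd (c.proj y) (c.proj_mem y) (h ▸ d.proj_mem z)
  obtain ⟨u, hu⟩ := w.exists_proj_eq hxw
  have hus : (u : E n) ∈ ρ.source := hρs ▸ u.2
  have hus' : (u : E n) ∈ σ.source := hσs ▸ u.2
  have e1 := hρ.proj_eq u hus
  have e2 := hσ.proj_eq u hus'
  obtain ⟨γ, hγ⟩ := c.proj_eq_iff.1 (e1.trans hu)
  obtain ⟨δ, hδ⟩ := d.proj_eq_iff.1 (h.symm.trans (hu.symm.trans e2.symm))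
  obtain ⟨a, ha, has, hav⟩ := exists_isTransition_smul c γ
  obtain ⟨b, hb, hbs, hbv⟩ := exists_isTransition_smul d δ
  have hay : a y = ρ u := by rw [hav, hγ]
  have hbz : b (σ u) = z := by
    have := hbv ⟨σ u, hσ.target_subset (σ.map_source hus')⟩
    rw [hδ] at this
    exact this
  have hinv : ρ.symm (ρ u) = u := ρ.left_inv hus
  refine ⟨((a.trans ρ.symm).trans σ).trans b, ((ha.trans hρ.symm).trans hσ).trans hb, ?_, ?_⟩
  · simp only [OpenPartialHomeomorph.trans_source, OpenPartialHomeomorph.coe_trans, mem_inter_iff,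
      mem_preimage, Function.comp, hay, hinv, has, hbs, OpenPartialHomeomorph.symm_source]
    exact ⟨⟨⟨y.2, ρ.map_source hus⟩, hus'⟩, hσ.target_subset (σ.map_source hus')⟩
  · simp only [OpenPartialHomeomorph.coe_trans, Function.comp, hay, hinv, hbz]

theorem proj_mem_singularSet_iff {c : OrbifoldChart n M} (hc : c ∈ O.charts) {y : c.Uhat} :
    c.proj y ∈ O.singularSet ↔ y ∉ c.free := by
  constructor
  · rintro ⟨d, hd, z, hz, hst⟩ hy
    rw [Ne, ← d.mem_free_iff] at hst
    apply hst
    intro γ hγ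
    obtain ⟨η, hη, hys, hηy⟩ := O.exists_isTransition hc hd hz.symm
    obtain ⟨a, ha, has, hav⟩ := exists_isTransition_smul d γ
    have haz : a z = z := by rw [hav, hγ]
    have hys' : (y : E n) ∈ (η.trans a).source := by
      rw [OpenPartialHomeomorph.trans_source]
      refine ⟨hys, ?_⟩
      change η y ∈ a.source
      rw [hηy, has]
      exact z.2
    have hev := hη.eventuallyEq (hη.trans ha) hy hys hys' (by
      change η y = a (η y)
      rw [hηy, haz])
    have hz_mem : (z : E n) ∈ η.target := hηy ▸ η.map_source hys
    have hsz : η.symm z = y := by rw [← hηy, η.left_inv hys]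
    have hev2 : ∀ᶠ w in 𝓝 (z : E n), a w = w := by
      have := (η.symm.continuousAt hz_mem).eventually (by
        change ∀ᶠ x in 𝓝 (η.symm z), _
        rw [hsz]
        exact hev)
      filter_upwards [this, η.open_target.mem_nhds hz_mem] with w hw hwt
      have h1 : η (η.symm w) = a (η (η.symm w)) := hw
      rw [η.right_inv hwt] at h1
      exact h1.symm
    obtain ⟨V, hV, hVo, hzV⟩ := eventually_nhds_iff.1 hev2
    have := d.effective γ γ.2 (Subtype.val ⁻¹' V) (hVo.preimage continuous_subtype_val)
      ⟨z, hzV⟩ fun x hx => Subtype.ext ((hav x).symm.trans (hV x hx))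
    exact Subtype.ext this
  · intro h
    exact ⟨c, hc, y, rfl, fun h' => h (c.mem_free_iff.2 h')⟩

theorem preimage_compl_singularSet {c : OrbifoldChart n M} (hc : c ∈ O.charts) :
    c.proj ⁻¹' O.singularSetᶜ = c.free := by
  ext y
  simp [O.proj_mem_singularSet_iff hc]

theorem image_free {c : OrbifoldChart n M} (hc : c ∈ O.charts) :
    c.proj '' c.free = (c.U : Set M) ∩ O.singularSetᶜ := by
  rw [← O.preimage_compl_singularSet hc, image_preimage_eq_range_inter, c.range_proj]

theorem isOpen_compl_singularSet : IsOpen O.singularSetᶜ := by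
  have : O.singularSetᶜ = ⋃ c : O.charts, c.1.proj '' c.1.free := by
    ext x
    simp only [mem_iUnion]
    constructor
    · intro hx
      obtain ⟨c, hc, hxc⟩ := O.cover x
      exact ⟨⟨c, hc⟩, by rw [O.image_free hc]; exact ⟨hxc, hx⟩⟩
    · rintro ⟨c, hx⟩
      rw [O.image_free c.2] at hx
      exact hx.2
  rw [this]
  exact isOpen_iUnion fun c => c.1.isOpenMap_proj _ c.1.isOpen_free

/-! ### Tangent vectors -/

theorem LocalVector.equivalence_rel : Equivalence (LocalVector.Rel (O := O)) where
  refl p := by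
    obtain ⟨η, hη, hs, hv⟩ := exists_isTransition_smul p.chart.1 1
    refine ⟨η, hη, hs ▸ p.pt.2, by rw [hv, one_smul], ?_⟩
    have : η =ᶠ[𝓝 (p.pt : E n)] id := by
      filter_upwards [p.chart.1.Uhat.isOpen.mem_nhds p.pt.2] with x hx
      have := hv ⟨x, hx⟩
      rwa [one_smul] at this
    rw [this.fderiv_eq]
    simp
  symm := by
    rintro p q ⟨η, hη, hs, hv, hd⟩
    have hq : (q.pt : E n) ∈ η.target := hv ▸ η.map_source hs
    refine ⟨η.symm, hη.symm, hq, by rw [← hv, η.left_inv hs], ?_⟩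
    have h1 : DifferentiableAt ℝ η p.pt :=
      (hη.contDiffAt hs).differentiableAt (by simp)
    have h2 : DifferentiableAt ℝ η.symm (η p.pt) := by
      rw [hv]
      exact (hη.symm.contDiffAt (x := q.pt) hq).differentiableAt (by simp)
    have h3 : η.symm ∘ η =ᶠ[𝓝 (p.pt : E n)] id := by
      filter_upwards [η.open_source.mem_nhds hs] with x hx
      exact η.left_inv hx
    have h4 := h3.fderiv_eq (𝕜 := ℝ)
    rw [fderiv_comp _ h2 h1, hv] at h4
    rw [← hd]
    simpa using congrArg (fun L => L p.vec) h4
  trans := by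
    rintro p q r ⟨η, hη, hs, hv, hd⟩ ⟨σ, hσ, hs', hv', hd'⟩
    refine ⟨η.trans σ, hη.trans hσ, ?_, ?_, ?_⟩
    · rw [OpenPartialHomeomorph.trans_source]
      refine ⟨hs, ?_⟩
      change η p.pt ∈ σ.source
      rwa [hv]
    · change σ (η p.pt) = r.pt
      rw [hv, hv']
    · have h1 : DifferentiableAt ℝ η p.pt :=
        (hη.contDiffAt hs).differentiableAt (by simp)
      have h2 : DifferentiableAt ℝ σ (η p.pt) := by
        rw [hv]
        exact (hσ.contDiffAt hs').differentiableAt (by simp)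
      rw [OpenPartialHomeomorph.coe_trans, fderiv_comp _ h2 h1, hv]
      simp [hd, hd']

theorem TangentBundle.rel_of_mk_eq {O : Orbifold n M} {c d : O.charts} {y : c.1.Uhat}
    {z : d.1.Uhat} {v w : E n} (h : TangentBundle.mk c y v = TangentBundle.mk d z w) :
    LocalVector.Rel (O := O) ⟨c, y, v⟩ ⟨d, z, w⟩ :=
  (LocalVector.equivalence_rel O).eqvGen_iff.1 (Quot.eqvGen_exact h)

theorem VectorField.contDiffOn_lift {O : Orbifold n M} {k : ℕ∞} (X : O.VectorField k)
    (c : O.charts) : ContDiffOn ℝ k (X.lift c) c.1.Uhat :=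
  (X.exists_lift c).choose_spec.1

theorem VectorField.toFun_proj {O : Orbifold n M} {k : ℕ∞} (X : O.VectorField k) (c : O.charts)
    (y : c.1.Uhat) : X.toFun (c.1.proj y) = TangentBundle.mk c y (X.lift c y) :=
  (X.exists_lift c).choose_spec.2 y

/-- At free points the differential of each transition maps local lifts of an orbitangent vector
field to each other. -/
theorem VectorField.fderiv_lift {O : Orbifold n M} {k : ℕ∞} (X : O.VectorField k) {c d : O.charts}
    {η : OpenPartialHomeomorph (E n) (E n)} (hη : IsTransition c.1 d.1 η) {y : c.1.Uhat}
    (hy : y ∈ c.1.free) (hys : (y : E n) ∈ η.source) :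
    fderiv ℝ η y (X.lift c y) = X.lift d (η y) := by
  let z : d.1.Uhat := ⟨η y, hη.target_subset (η.map_source hys)⟩
  have hz : d.1.proj z = c.1.proj y := hη.proj_eq y hys
  have h := X.toFun_proj c y
  rw [← hz, X.toFun_proj d z] at h
  obtain ⟨σ, hσ, hσs, hσv, hσd⟩ := TangentBundle.rel_of_mk_eq h.symm
  have := (hη.eventuallyEq hσ hy hys hσs hσv.symm).fderiv_eq (𝕜 := ℝ)
  rw [this]
  exact hσd

end Orbifold

end Orbi

namespace Orbi

/-! ### Determinants and traces -/

/-- Jacobi's formula for the derivative of a determinant. -/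
theorem hasFDerivAt_det {ι F : Type*} [Fintype ι] [DecidableEq ι] [NormedAddCommGroup F]
    [NormedSpace ℝ F] {A : F → Matrix ι ι ℝ} {A' : ι → ι → F →L[ℝ] ℝ} {x : F}
    (h : ∀ i j, HasFDerivAt (fun y => A y i j) (A' i j) x) :
    HasFDerivAt (fun y => (A y).det) (∑ i, ∑ j, (A x).adjugate i j • A' j i) x := by
  have h1 : HasFDerivAt (fun y => (A y).det)
      (∑ σ : Equiv.Perm ι, ((Equiv.Perm.sign σ : ℤ) : ℝ) •
        ∑ i, (∏ j ∈ Finset.univ.erase i, A x (σ j) j) • A' (σ i) i) x := by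
    simp_rw [Matrix.det_apply']
    refine HasFDerivAt.fun_sum fun σ _ => HasFDerivAt.const_mul ?_ _
    exact HasFDerivAt.finsetProd fun i _ => h (σ i) i
  convert h1 using 1
  ext v
  have key : ∀ i, ∑ j, (A x).adjugate i j * A' j i v =
      ((A x).updateCol i fun j => A' j i v).det := by
    intro i
    rw [← Matrix.cramer_apply, Matrix.cramer_eq_adjugate_mulVec]
    rfl
  simp only [sum_apply, smul_apply, smul_eq_mul]
  simp_rw [key, Matrix.det_apply', Finset.mul_sum]
  rw [Finset.sum_comm]
  refine Finset.sum_congr rfl fun σ _ => Finset.sum_congr rfl fun i _ => ?_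
  rw [← Finset.prod_erase_mul _ _ (Finset.mem_univ i)]
  congr 2
  · refine Finset.prod_congr rfl fun j hj => ?_
    rw [Matrix.updateCol_ne (Finset.ne_of_mem_erase hj)]
  · rw [Matrix.updateCol_self]

variable {n : ℕ}

/-- The matrix of an endomorphism of `ℝⁿ`. -/
noncomputable def toMat (L : E n →L[ℝ] E n) : Matrix (Fin n) (Fin n) ℝ :=
  Matrix.of fun i j => L (basisVec j) i

theorem toMat_eq_toMatrix (L : E n →L[ℝ] E n) :
    toMat L = LinearMap.toMatrix (EuclideanSpace.basisFun (Fin n) ℝ).toBasis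
      (EuclideanSpace.basisFun (Fin n) ℝ).toBasis (L : E n →ₗ[ℝ] E n) := by
  ext i j
  simp [toMat, LinearMap.toMatrix_apply, basisVec]

theorem toMat_comp (L L' : E n →L[ℝ] E n) : toMat (L ∘L L') = toMat L * toMat L' := by
  simp only [toMat_eq_toMatrix]
  exact LinearMap.toMatrix_comp _ _ _ _ _

theorem toMat_id : toMat (ContinuousLinearMap.id ℝ (E n)) = 1 := by
  rw [toMat_eq_toMatrix]
  exact LinearMap.toMatrix_id _

theorem det_toMat (L : E n →L[ℝ] E n) : (toMat L).det = L.det := by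
  rw [toMat_eq_toMatrix, LinearMap.det_toMatrix]

theorem trace_toMat_fderiv {V : E n → E n} {x : E n} (hV : DifferentiableAt ℝ V x) :
    (toMat (fderiv ℝ V x)).trace = ∑ i, partialDeriv i (fun y => V y i) x := by
  refine Finset.sum_congr rfl fun i _ => ?_
  have h := ((EuclideanSpace.proj (𝕜 := ℝ) i).hasFDerivAt.comp x hV.hasFDerivAt).fderiv
  have h' : fderiv ℝ (fun y => V y i) x = (EuclideanSpace.proj (𝕜 := ℝ) i) ∘L fderiv ℝ V x := h
  simp [partialDeriv, toMat, h']

theorem eq_sum_basisVec (v : E n) : v = ∑ i, v i • basisVec i := by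
  ext j
  simp [basisVec, Pi.single_apply]

/-- Jacobi's formula for an invertible endomorphism. -/
theorem hasFDerivAt_det_of_inverse {F : Type*} [NormedAddCommGroup F] [NormedSpace ℝ F]
    {A : F → E n →L[ℝ] E n} {A' : F →L[ℝ] E n →L[ℝ] E n} {x : F} (h : HasFDerivAt A A' x)
    {B : E n →L[ℝ] E n} (hB : B ∘L A x = .id ℝ _) :
    ∃ J' : F →L[ℝ] ℝ, HasFDerivAt (fun y => (toMat (A y)).det) J' x ∧
      ∀ v, J' v = (toMat (A x)).det * (toMat (B ∘L A' v)).trace := by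
  have h1 : ∀ i j, HasFDerivAt (fun y => toMat (A y) i j)
      ((EuclideanSpace.proj (𝕜 := ℝ) i) ∘L
        ((ContinuousLinearMap.apply ℝ (E n) (basisVec j)) ∘L A')) x := fun i j =>
    (EuclideanSpace.proj (𝕜 := ℝ) i).hasFDerivAt.comp x
      ((ContinuousLinearMap.apply ℝ (E n) (basisVec j)).hasFDerivAt.comp x h)
  refine ⟨_, hasFDerivAt_det h1, fun v => ?_⟩
  have h2 : toMat B * toMat (A x) = 1 := by rw [← toMat_comp, hB, toMat_id]
  have h3 : (toMat (A x)).adjugate = (toMat (A x)).det • toMat B := by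
    have := congrArg (fun P => toMat B * P) (Matrix.mul_adjugate (toMat (A x)))
    simp only [← mul_assoc, h2, one_mul, mul_smul_comm, mul_one] at this
    rw [this]
  rw [h3, toMat_comp]
  simp [Matrix.trace, Matrix.mul_apply, Finset.mul_sum, toMat, mul_assoc]

/-! ### The divergence in coordinates -/

section LocalDiv

variable {g g' : E n → E n →L[ℝ] E n →L[ℝ] ℝ} {V V' : E n → E n} {x : E n}

theorem differentiableAt_metricMatrix (hg : DifferentiableAt ℝ g x) (i j : Fin n) :
    DifferentiableAt ℝ (fun y => metricMatrix g y i j) x := by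
  change DifferentiableAt ℝ (fun y => g y (basisVec i) (basisVec j)) x
  fun_prop

theorem differentiableAt_det_metricMatrix (hg : DifferentiableAt ℝ g x) :
    DifferentiableAt ℝ (fun y => (metricMatrix g y).det) x :=
  (hasFDerivAt_det fun i j => (differentiableAt_metricMatrix hg i j).hasFDerivAt).differentiableAt

theorem metricMatrix_posDef (hs : ∀ v w, g x v w = g x w v) (hp : ∀ v, v ≠ 0 → 0 < g x v v) :
    (metricMatrix g x).PosDef := by
  refine Matrix.PosDef.of_dotProduct_mulVec_pos ?_ fun v hv => ?_
  · ext i j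
    simp [metricMatrix, hs (basisVec i)]
  · have hne : WithLp.toLp 2 v ≠ (0 : E n) := by
      intro h
      apply hv
      ext i
      simpa using congrArg (fun u : E n => u i) h
    have := hp _ hne
    rw [eq_sum_basisVec (WithLp.toLp 2 v)] at this
    have e : g x (∑ i, v i • basisVec i) (∑ i, v i • basisVec i) =
        star v ⬝ᵥ (metricMatrix g x).mulVec v := by
      simp only [map_sum, map_smul, sum_apply, smul_apply, smul_eq_mul, dotProduct, Matrix.mulVec,
        metricMatrix, Matrix.of_apply, Finset.mul_sum, star_trivial]
      rw [Finset.sum_comm]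
      refine Finset.sum_congr rfl fun i _ => Finset.sum_congr rfl fun j _ => ?_
      ring
    exact e ▸ this

/-- The divergence in terms of the derivative of `det (g_ij)`. -/
theorem localDiv_eq (hg : DifferentiableAt ℝ g x) (hV : DifferentiableAt ℝ V x)
    (hs : ∀ᶠ y in 𝓝 x, ∀ v w, g y v w = g y w v) (hp : ∀ v, v ≠ 0 → 0 < g x v v) :
    localDiv g V x = (toMat (fderiv ℝ V x)).trace +
      fderiv ℝ (fun y => (metricMatrix g y).det) x (V x) / (2 * (metricMatrix g x).det) := by
  have hdet : (metricMatrix g x).det ≠ 0 := (metricMatrix_posDef hs.self_of_nhds hp).det_pos.ne'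
  have hsym : ∀ i j, (metricMatrix g x)⁻¹ i j = (metricMatrix g x)⁻¹ j i := fun i j => by
    have : (metricMatrix g x).transpose = metricMatrix g x := by
      ext i j
      exact hs.self_of_nhds _ _
    conv_lhs => rw [← this, ← Matrix.transpose_nonsing_inv]
    rfl
  have hsymD : ∀ l i j, partialDeriv l (fun y => metricMatrix g y i j) x =
      partialDeriv l (fun y => metricMatrix g y j i) x := by
    intro l i j
    unfold partialDeriv
    rw [Filter.EventuallyEq.fderiv_eq (f := fun y => metricMatrix g y j i)]
    filter_upwards [hs] with y hy
    exact hy _ _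
  have hinv : ∀ i j, (metricMatrix g x)⁻¹ i j =
      (metricMatrix g x).adjugate i j / (metricMatrix g x).det := by
    intro i j
    rw [Matrix.inv_def, Ring.inverse_eq_inv']
    simp [div_eq_inv_mul]
  have hΓ : ∀ j, ∑ i, christoffel g x i i j =
      fderiv ℝ (fun y => (metricMatrix g y).det) x (basisVec j) /
        (2 * (metricMatrix g x).det) := by
    intro j
    have e1 : ∑ i, ∑ l, (metricMatrix g x)⁻¹ i l *
        partialDeriv i (fun y => metricMatrix g y j l) x =
        ∑ i, ∑ l, (metricMatrix g x)⁻¹ i l * partialDeriv l (fun y => metricMatrix g y i j) x := by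
      rw [Finset.sum_comm]
      refine Finset.sum_congr rfl fun i _ => Finset.sum_congr rfl fun l _ => ?_
      rw [hsym, hsymD]
    have e2 : fderiv ℝ (fun y => (metricMatrix g y).det) x (basisVec j) =
        ∑ i, ∑ l, (metricMatrix g x).adjugate i l *
          partialDeriv j (fun y => metricMatrix g y i l) x := by
      rw [(hasFDerivAt_det fun i j =>
        (differentiableAt_metricMatrix hg i j).hasFDerivAt).fderiv]
      simp only [sum_apply, smul_apply, smul_eq_mul]
      refine Finset.sum_congr rfl fun i _ => Finset.sum_congr rfl fun l _ => ?_
      rw [hsymD]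
      rfl
    unfold christoffel
    simp only [mul_add, mul_sub, Finset.sum_add_distrib, Finset.sum_sub_distrib, ← Finset.mul_sum]
    rw [e1, e2]
    simp only [hinv, Finset.sum_div, Finset.mul_sum, div_mul_eq_mul_div]
    rw [add_sub_cancel_left]
    refine Finset.sum_congr rfl fun i _ => Finset.sum_congr rfl fun l _ => ?_
    field_simp
  unfold localDiv covDeriv
  rw [Finset.sum_add_distrib, ← trace_toMat_fderiv hV, Finset.sum_comm]
  congr 1
  simp_rw [← Finset.sum_mul, hΓ]
  conv_rhs => rw [eq_sum_basisVec (V x), map_sum, Finset.sum_div]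
  refine Finset.sum_congr rfl fun j _ => ?_
  rw [map_smul, smul_eq_mul]
  ring

theorem metricMatrix_pullback (L : E n →L[ℝ] E n) {y z : E n}
    (h : ∀ v w, g' z (L v) (L w) = g y v w) :
    metricMatrix g y = (toMat L).transpose * metricMatrix g' z * toMat L := by
  ext i j
  have e : g y (basisVec i) (basisVec j) = _ := (h (basisVec i) (basisVec j)).symm
  rw [eq_sum_basisVec (L (basisVec i)), eq_sum_basisVec (L (basisVec j))] at e
  simp only [map_sum, map_smul, sum_apply, smul_apply,
    smul_eq_mul] at e
  simp only [metricMatrix, Matrix.mul_apply, Matrix.of_apply, Matrix.transpose_apply, toMat]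
  rw [e]
  refine Finset.sum_congr rfl fun k _ => ?_
  simp [Finset.mul_sum, mul_comm, mul_left_comm]

theorem det_metricMatrix_pullback (L : E n →L[ℝ] E n) {y z : E n}
    (h : ∀ v w, g' z (L v) (L w) = g y v w) :
    (metricMatrix g y).det = (toMat L).det ^ 2 * (metricMatrix g' z).det := by
  rw [metricMatrix_pullback L h, Matrix.det_mul, Matrix.det_mul, Matrix.det_transpose]
  ring

/-- The divergence is invariant under local diffeomorphisms. -/
theorem localDiv_pullback {η : E n → E n} (hη : ContDiffAt ℝ ∞ η x)
    {B : E n →L[ℝ] E n} (hB : B ∘L fderiv ℝ η x = .id ℝ _)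
    (hg : DifferentiableAt ℝ g x) (hV : DifferentiableAt ℝ V x)
    (hs : ∀ᶠ y in 𝓝 x, ∀ v w, g y v w = g y w v) (hp : ∀ v, v ≠ 0 → 0 < g x v v)
    (hg' : DifferentiableAt ℝ g' (η x)) (hV' : DifferentiableAt ℝ V' (η x))
    (hs' : ∀ᶠ y in 𝓝 (η x), ∀ v w, g' y v w = g' y w v) (hp' : ∀ v, v ≠ 0 → 0 < g' (η x) v v)
    (hgg : ∀ᶠ y in 𝓝 x, ∀ v w, g' (η y) (fderiv ℝ η y v) (fderiv ℝ η y w) = g y v w)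
    (hVV : ∀ᶠ y in 𝓝 x, fderiv ℝ η y (V y) = V' (η y)) :
    localDiv g V x = localDiv g' V' (η x) := by
  have h2 : ((1 : WithTop ℕ∞) + 1) ≤ ∞ := WithTop.coe_le_coe.2 (le_top (a := (1 + 1 : ℕ∞)))
  have hD : DifferentiableAt ℝ (fderiv ℝ η) x :=
    (hη.fderiv_right (m := 1) h2).differentiableAt one_ne_zero
  have hη1 : DifferentiableAt ℝ η x := hη.differentiableAt (by simp)
  have hsymm := hη.isSymmSndFDerivAt (by simpa [one_add_one_eq_two] using h2)
  obtain ⟨J', hJ, hJ'⟩ := hasFDerivAt_det_of_inverse hD.hasFDerivAt hB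
  set A := fderiv ℝ η x with hA
  set G' := fderiv ℝ (fun y => (metricMatrix g' y).det) (η x) with hG'
  have hdG' := (differentiableAt_det_metricMatrix hg').hasFDerivAt
  have hpos' := (metricMatrix_posDef hs'.self_of_nhds hp').det_pos
  have hBA : toMat B * toMat A = 1 := by rw [← toMat_comp, hB, toMat_id]
  have hJ0 : (toMat A).det ≠ 0 := by
    intro h
    have := congrArg Matrix.det hBA
    rw [Matrix.det_mul, h] at this
    simp at this
  have hG : (fun y => (metricMatrix g y).det) =ᶠ[𝓝 x]
      fun y => (toMat (fderiv ℝ η y)).det ^ 2 * (metricMatrix g' (η y)).det := by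
    filter_upwards [hgg] with y hy
    exact det_metricMatrix_pullback _ hy
  have hGx : (metricMatrix g x).det = _ := hG.self_of_nhds
  have hdG : HasFDerivAt (fun y => (metricMatrix g y).det) _ x :=
    ((hJ.pow 2).mul (hdG'.comp x hη1.hasFDerivAt)).congr_of_eventuallyEq hG
  have hVx : A (V x) = V' (η x) := hVV.self_of_nhds
  have h1 : HasFDerivAt (fun y => V' (η y)) (fderiv ℝ V' (η x) ∘L A) x :=
    hV'.hasFDerivAt.comp x hη1.hasFDerivAt
  have h2' := (hD.hasFDerivAt.clm_apply hV.hasFDerivAt)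
  have h3 := h2'.unique (h1.congr_of_eventuallyEq hVV)
  have h4 : fderiv ℝ V' (η x) ∘L A = A ∘L fderiv ℝ V x + fderiv ℝ (fderiv ℝ η) x (V x) := by
    rw [← h3]
    ext1 v
    simp only [add_apply, ContinuousLinearMap.comp_apply,
      ContinuousLinearMap.flip_apply]
    rw [hsymm v (V x)]
  have h5 : (toMat (fderiv ℝ V' (η x))).trace = (toMat (fderiv ℝ V x)).trace +
      (toMat (B ∘L fderiv ℝ (fderiv ℝ η) x (V x))).trace := by
    have hAB : toMat A * toMat B = 1 := mul_eq_one_comm.1 hBA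
    have e : toMat (B ∘L (fderiv ℝ V' (η x) ∘L A)) =
        toMat (fderiv ℝ V x) + toMat (B ∘L fderiv ℝ (fderiv ℝ η) x (V x)) := by
      rw [h4, ContinuousLinearMap.comp_add, ← ContinuousLinearMap.comp_assoc, hB]
      rfl
    rw [← Matrix.trace_add, ← e, toMat_comp, toMat_comp, Matrix.trace_mul_comm, mul_assoc, hAB,
      mul_one]
  rw [localDiv_eq hg hV hs hp, localDiv_eq hg' hV' hs' hp', hdG.fderiv, hGx, h5, ← hVx]
  simp only [add_apply, smul_apply,
    ContinuousLinearMap.comp_apply, smul_eq_mul, hJ', ← hA, ← hG']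
  simp
  field_simp
  ring

end LocalDiv

end Orbi

namespace Orbi

variable {n : ℕ} {M : Type*} [TopologicalSpace M]

/-! ### The points with non-trivial stabilizer form a null set -/

namespace OrbifoldChart

variable (c : OrbifoldChart n M)

/-- A non-trivial element of `Γ` has a non-trivial differential at each fixed point. -/
theorem fderiv_ne_id {γ : c.Γ} (hγ : γ ≠ 1) {η : OpenPartialHomeomorph (E n) (E n)}
    (hη : IsTransition c c η) (hs : η.source = c.Uhat) (hv : ∀ y : c.Uhat, η y = (γ • y : c.Uhat))
    {y : c.Uhat} (hy : η y = y) : fderiv ℝ η y ≠ .id ℝ _ := by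
  intro hd
  have hst : HasStrictFDerivAt η (ContinuousLinearMap.id ℝ (E n)) y := by
    rw [← hd]
    exact (hη.contDiffAt (hs ▸ y.2)).hasStrictFDerivAt (by simp)
  set m := orderOf γ with hm
  have hm0 : 0 < m := orderOf_pos γ
  let A : E n → E n := fun x => (m : ℝ)⁻¹ • ∑ j ∈ Finset.range m, η^[j] x
  have hA : HasStrictFDerivAt A ((ContinuousLinearEquiv.refl ℝ (E n) : E n ≃L[ℝ] E n) :
      E n →L[ℝ] E n) y := by
    have h1 : HasStrictFDerivAt A
        ((m : ℝ)⁻¹ • ∑ j ∈ Finset.range m, (ContinuousLinearMap.id ℝ (E n)) ^ j) y :=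
      (HasStrictFDerivAt.fun_sum fun j _ => hst.iterate hy j).const_smul (m : ℝ)⁻¹
    convert h1 using 1
    have : ∀ j : ℕ, (ContinuousLinearMap.id ℝ (E n)) ^ j = ContinuousLinearMap.id ℝ (E n) :=
      fun j => one_pow j
    simp_rw [this]
    rw [Finset.sum_const, Finset.card_range, ← Nat.cast_smul_eq_nsmul ℝ, smul_smul,
      inv_mul_cancel₀ (by positivity), one_smul]
    rfl
  have hiter : ∀ (j : ℕ) (x : c.Uhat), η^[j] x = (γ ^ j • x : c.Uhat) := by
    intro j
    induction j with
    | zero => intro x; simp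
    | succ j ih =>
      intro x
      rw [Function.iterate_succ_apply', ih, hv, smul_smul, pow_succ']
  have hAη : ∀ x : c.Uhat, A (η x) = A x := by
    intro x
    have h1 : ∀ j, η^[j] (η x) = η^[j + 1] x := fun j => rfl
    have h2 := Finset.sum_range_succ' (fun j => η^[j] (x : E n)) m
    rw [Finset.sum_range_succ, hiter m, hm, pow_orderOf_eq_one, one_smul] at h2
    simp only [A, h1]
    rw [hm, add_right_cancel h2]
  let P := hA.toOpenPartialHomeomorph A
  have hyP : (y : E n) ∈ P.source := hA.mem_toOpenPartialHomeomorph_source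
  have hev : ∀ᶠ x in 𝓝 (y : E n), η x = x := by
    have h1 := P.open_source.mem_nhds hyP
    have h2 : ∀ᶠ x in 𝓝 (y : E n), η x ∈ P.source :=
      (η.continuousAt (hs ▸ y.2)).eventually (by rw [hy]; exact h1)
    filter_upwards [h1, h2, c.Uhat.isOpen.mem_nhds y.2] with x hx hx2 hxU
    exact P.injOn hx2 hx (hAη ⟨x, hxU⟩)
  obtain ⟨V, hV, hVo, hyV⟩ := eventually_nhds_iff.1 hev
  exact hγ (Subtype.ext (c.effective γ γ.2 (Subtype.val ⁻¹' V)
    (hVo.preimage continuous_subtype_val) ⟨y, hyV⟩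
    fun x hx => Subtype.ext ((hv x).symm.trans (hV x hx))))

theorem volume_fixedBy {γ : c.Γ} (hγ : γ ≠ 1) :
    volume (Subtype.val '' {y : c.Uhat | γ • y = y}) = 0 := by
  obtain ⟨η, hη, hs, hv⟩ := exists_isTransition_smul c γ
  set s : Set (E n) := Subtype.val '' {y : c.Uhat | γ • y = y} with hsdef
  have hfix : ∀ x ∈ s, η x = x := by
    rintro _ ⟨y, hy, rfl⟩
    rw [hv, hy]
  have hmeas : MeasurableSet s := by
    refine MeasurableSet.subtype_image c.Uhat.isOpen.measurableSet ?_
    have hcl : IsClosed {y : c.Uhat | γ • y = y} :=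
      isClosed_eq (continuous_const_smul γ) continuous_id
    exact hcl.measurableSet
  have hsub : ∀ x ∈ s, x ∈ η.source := by
    rintro _ ⟨y, hy, rfl⟩
    exact hs ▸ y.2
  have happ : ApproximatesLinearOn η (ContinuousLinearMap.id ℝ (E n)) s 0 := by
    intro x hx y hy
    simp [hfix x hx, hfix y hy]
  have h := happ.norm_fderiv_sub_le volume hmeas (fderiv ℝ η) fun x hx =>
    (((hη.contDiffAt (hsub x hx)).differentiableAt (by simp)).hasFDerivAt).hasFDerivWithinAt
  have h2 : ∀ᵐ x ∂(volume.restrict s), False := by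
    filter_upwards [h, ae_restrict_mem hmeas] with x hx hxs
    have hx0 : fderiv ℝ η x = ContinuousLinearMap.id ℝ (E n) := by
      have : ‖fderiv ℝ η x - ContinuousLinearMap.id ℝ (E n)‖₊ = 0 := le_antisymm hx zero_le
      exact sub_eq_zero.1 (nnnorm_eq_zero.1 this)
    have hxf := hfix x hxs
    obtain ⟨y, hy, rfl⟩ := hxs
    exact c.fderiv_ne_id hγ hη hs hv hxf hx0
  simpa [ae_iff] using h2

theorem volume_compl_free : volume (Subtype.val '' c.freeᶜ) = 0 := by
  have : Subtype.val '' c.freeᶜ ⊆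
      ⋃ γ : c.Γ, ⋃ _ : γ ≠ 1, Subtype.val '' {y : c.Uhat | γ • y = y} := by
    rintro _ ⟨y, hy, rfl⟩
    have hy' : ¬ ∀ γ : c.Γ, γ • y = y → γ = 1 := hy
    push Not at hy'
    obtain ⟨γ, h1, h2⟩ := hy'
    exact mem_iUnion₂.2 ⟨γ, h2, y, h1, rfl⟩
  refine measure_mono_null this (measure_iUnion_null fun γ => measure_iUnion_null fun hγ => ?_)
  exact c.volume_fixedBy hγ

end OrbifoldChart

/-! ### The divergence theorem for compactly supported fields in coordinates -/

theorem integral_trace_fderiv_eq_zero {W : E n → E n} (hW : ContDiff ℝ 1 W)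
    (hc : HasCompactSupport W) : ∫ x, (toMat (fderiv ℝ W x)).trace = 0 := by
  have hd : Continuous (fderiv ℝ W) := hW.continuous_fderiv one_ne_zero
  have hcd : HasCompactSupport (fderiv ℝ W) := hc.fderiv ℝ
  have hint : ∀ i : Fin n, Integrable (fun x => fderiv ℝ W x (basisVec i) i) := by
    intro i
    refine Continuous.integrable_of_hasCompactSupport (by fun_prop) ?_
    exact hcd.comp_left (g := fun L : E n →L[ℝ] E n => L (basisVec i) i) (by simp)
  have htr : ∀ x, (toMat (fderiv ℝ W x)).trace = ∑ i, fderiv ℝ W x (basisVec i) i :=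
    fun x => rfl
  simp_rw [htr]
  rw [integral_finsetSum _ fun i _ => hint i]
  refine Finset.sum_eq_zero fun i _ => ?_
  have hWi : ContDiff ℝ 1 fun x => W x i :=
    (EuclideanSpace.proj (𝕜 := ℝ) i).contDiff.comp hW
  have hfd : ∀ x, fderiv ℝ (fun x => W x i) x (basisVec i) = fderiv ℝ W x (basisVec i) i := by
    intro x
    have h := ((EuclideanSpace.proj (𝕜 := ℝ) i).hasFDerivAt.comp x
      (hW.differentiable one_ne_zero x).hasFDerivAt).fderiv
    exact congrArg (fun L : E n →L[ℝ] ℝ => L (basisVec i)) h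
  have hWint : Integrable fun x => W x i :=
    hWi.continuous.integrable_of_hasCompactSupport
      (hc.comp_left (g := fun u : E n => u i) (by simp))
  have := integral_mul_fderiv_eq_neg_fderiv_mul_of_integrable (μ := volume)
    (f := fun _ : E n => (1 : ℝ)) (g := fun x => W x i) (v := basisVec i)
    (by simp) (by simpa [hfd] using hint i) (by simpa using hWint)
    (by simp) (fun x _ => hWi.differentiable one_ne_zero x)
  simpa [hfd] using this

section

variable {g : E n → E n →L[ℝ] E n →L[ℝ] ℝ} {V : E n → E n} {x : E n} {f : E n → ℝ}

/-- The product rule for the divergence, in coordinates. -/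
theorem trace_fderiv_smul_sqrt_smul (hg : DifferentiableAt ℝ g x) (hV : DifferentiableAt ℝ V x)
    (hf : DifferentiableAt ℝ f x)
    (hs : ∀ᶠ y in 𝓝 x, ∀ v w, g y v w = g y w v) (hp : ∀ v, v ≠ 0 → 0 < g x v v) :
    (toMat (fderiv ℝ (fun y => (f y * Real.sqrt (metricMatrix g y).det) • V y) x)).trace =
      (f x * localDiv g V x + fderiv ℝ f x (V x)) * Real.sqrt (metricMatrix g x).det := by
  have hpos := (metricMatrix_posDef hs.self_of_nhds hp).det_pos
  have h1 := ((differentiableAt_det_metricMatrix hg).hasFDerivAt.sqrt hpos.ne')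
  have h2 : HasFDerivAt (fun y => (f y * Real.sqrt (metricMatrix g y).det) • V y) _ x :=
    (hf.hasFDerivAt.mul h1).smul hV.hasFDerivAt
  rw [h2.fderiv, localDiv_eq hg hV hs hp]
  have htr : ∀ (a : ℝ) (L : E n →L[ℝ] E n) (l : E n →L[ℝ] ℝ) (v : E n),
      (toMat (a • L + l.smulRight v)).trace = a * (toMat L).trace + l v := by
    intro a L l v
    have : l v = ∑ i, v i * l (basisVec i) := by
      conv_lhs => rw [eq_sum_basisVec v]
      simp
    rw [this]
    simp [Matrix.trace, toMat, Finset.sum_add_distrib, Finset.mul_sum, mul_comm]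
  rw [htr]
  have hsq : Real.sqrt (metricMatrix g x).det ≠ 0 := (Real.sqrt_pos.2 hpos).ne'
  have hsq2 := Real.mul_self_sqrt hpos.le
  rw [show 2 * (metricMatrix g x).det =
    2 * (Real.sqrt (metricMatrix g x).det * Real.sqrt (metricMatrix g x).det) by rw [hsq2]]
  simp only [add_apply, smul_apply, smul_eq_mul, Pi.mul_apply]
  field_simp
  ring

end

end Orbi

namespace Orbi

namespace Orbifold

variable {n : ℕ} {M : Type*} [TopologicalSpace M] {O : Orbifold n M} {k : ℕ∞}
  (g : O.RiemannianMetric k)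

namespace RiemannianMetric

/-! ### The volume density of a chart -/

theorem posDef (c : O.charts) {x : E n} (hx : x ∈ c.1.Uhat) :
    (metricMatrix (g.lift c) x).PosDef :=
  metricMatrix_posDef (g.symm c x hx) (g.pos c x hx)

/-- The volume density `√det(g_ij)` in a chart. -/
noncomputable def sqrtDet (c : O.charts) (x : E n) : ℝ :=
  Real.sqrt (metricMatrix (g.lift c) x).det

theorem contDiffOn_metricMatrix_det (c : O.charts) :
    ContDiffOn ℝ k (fun x => (metricMatrix (g.lift c) x).det) c.1.Uhat := by
  simp_rw [Matrix.det_apply']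
  refine ContDiffOn.sum fun σ _ => contDiffOn_const.mul (contDiffOn_prod fun i _ => ?_)
  exact ((g.contDiffOn c).clm_apply contDiffOn_const).clm_apply contDiffOn_const

theorem contDiffOn_sqrtDet (c : O.charts) : ContDiffOn ℝ k (g.sqrtDet c) c.1.Uhat :=
  (g.contDiffOn_metricMatrix_det c).sqrt fun _ hx => (g.posDef c hx).det_pos.ne'

theorem continuous_sqrtDet (c : O.charts) : Continuous fun y : c.1.Uhat => g.sqrtDet c y :=
  continuousOn_iff_continuous_domRestrict.1 (g.contDiffOn_sqrtDet c).continuousOn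

theorem sqrtDet_eq {c d : O.charts} {η : OpenPartialHomeomorph (E n) (E n)}
    (hη : IsTransition c.1 d.1 η) {x : E n} (hx : x ∈ η.source) :
    g.sqrtDet c x = |(fderiv ℝ η x).det| * g.sqrtDet d (η x) := by
  unfold sqrtDet
  rw [det_metricMatrix_pullback _ (g.compat c d η hη x hx), Real.sqrt_mul (sq_nonneg _),
    Real.sqrt_sq_eq_abs, det_toMat]

/-- The Riemannian measure on the domain `Û` of a chart. -/
noncomputable def chartMeasure (c : O.charts) : Measure c.1.Uhat :=
  ((volume : Measure (E n)).comap Subtype.val).withDensity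
    fun y => ENNReal.ofReal (g.sqrtDet c y)

theorem measurableEmbedding_coe (c : O.charts) :
    MeasurableEmbedding (Subtype.val : c.1.Uhat → E n) :=
  MeasurableEmbedding.subtype_coe c.1.Uhat.isOpen.measurableSet

theorem chartMeasure_apply (c : O.charts) {S : Set c.1.Uhat} (hS : MeasurableSet S) :
    g.chartMeasure c S = ∫⁻ x in Subtype.val '' S, ENNReal.ofReal (g.sqrtDet c x) := by
  have he := measurableEmbedding_coe c
  have hsub : Subtype.val '' S ⊆ (c.1.Uhat : Set (E n)) := by
    rintro _ ⟨y, _, rfl⟩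
    exact y.2
  have h1 : (volume : Measure (E n)).restrict (Subtype.val '' S) =
      ((((volume : Measure (E n)).comap Subtype.val).restrict S).map
        (Subtype.val : c.1.Uhat → E n)) := by
    have h2 := he.restrict_map ((volume : Measure (E n)).comap Subtype.val) (Subtype.val '' S)
    rw [preimage_image_eq _ Subtype.val_injective] at h2
    rw [← h2, he.map_comap, Subtype.range_coe, Measure.restrict_restrict
      (he.measurableSet_image.2 hS), inter_eq_left.2 hsub]
  rw [h1, he.lintegral_map, chartMeasure, withDensity_apply _ hS]

theorem chartMeasure_compl_free (c : O.charts) : g.chartMeasure c c.1.freeᶜ = 0 := by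
  rw [g.chartMeasure_apply c c.1.isOpen_free.measurableSet.compl]
  exact setLIntegral_measure_zero _ _ c.1.volume_compl_free

variable [MeasurableSpace M]

theorem patchMeasure_eq (c : O.charts) {V : Set c.1.Uhat} (hV : IsOpen V) :
    g.patchMeasure c V = ((g.chartMeasure c).restrict V).map c.1.proj := by
  unfold patchMeasure chartMeasure
  rw [restrict_withDensity hV.measurableSet]
  rfl

theorem patchMeasure_le_vol (c : O.charts) {V : Set c.1.Uhat} (hV : IsOpen V)
    (hVi : InjOn c.1.proj V) : g.patchMeasure c V ≤ g.vol :=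
  le_iSup_of_le c (le_iSup_of_le V (le_iSup_of_le ⟨hV, hVi⟩ le_rfl))

variable [BorelSpace M]

theorem patchMeasure_apply (c : O.charts) {V : Set c.1.Uhat} (hV : IsOpen V) {A : Set M}
    (hA : MeasurableSet A) : g.patchMeasure c V A = g.chartMeasure c (c.1.proj ⁻¹' A ∩ V) := by
  rw [g.patchMeasure_eq c hV, Measure.map_apply c.1.continuous_proj.measurable hA,
    Measure.restrict_apply (c.1.continuous_proj.measurable hA)]

/-- Where the images of two coordinate patches overlap, their measures agree. -/
theorem restrict_patchMeasure_le (c d : O.charts) {V : Set c.1.Uhat} {W : Set d.1.Uhat}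
    (hV : IsOpen V) (hVi : InjOn c.1.proj V) (hW : IsOpen W) (hWi : InjOn d.1.proj W) :
    (g.patchMeasure d W).restrict (c.1.proj '' V) ≤ g.patchMeasure c V := by
  classical
  have hPV : MeasurableSet (c.1.proj '' V) := (c.1.isOpenMap_proj V hV).measurableSet
  refine Measure.le_iff.2 fun A hA => ?_
  rw [Measure.restrict_apply hA, g.patchMeasure_apply d hW (hA.inter hPV),
    g.patchMeasure_apply c hV hA]
  have hS : MeasurableSet (d.1.proj ⁻¹' (A ∩ c.1.proj '' V) ∩ W) :=
    (d.1.continuous_proj.measurable (hA.inter hPV)).inter hW.measurableSet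
  have hS' : MeasurableSet (c.1.proj ⁻¹' A ∩ V) :=
    (c.1.continuous_proj.measurable hA).inter hV.measurableSet
  rw [g.chartMeasure_apply d hS, g.chartMeasure_apply c hS']
  set S := d.1.proj ⁻¹' (A ∩ c.1.proj '' V) ∩ W
  let τ : E n → E n := fun x =>
    if h : ∃ y ∈ V, ∃ hx : x ∈ d.1.Uhat, c.1.proj y = d.1.proj ⟨x, hx⟩ then h.choose else 0
  have hτ : ∀ (z : d.1.Uhat) (y : c.1.Uhat), y ∈ V → c.1.proj y = d.1.proj z → τ z = y := by
    intro z y hy hyz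
    have h : ∃ y ∈ V, ∃ hx : (z : E n) ∈ d.1.Uhat, c.1.proj y = d.1.proj ⟨z, hx⟩ :=
      ⟨y, hy, z.2, hyz⟩
    obtain ⟨h1, _, h2⟩ := h.choose_spec
    simp only [τ, dif_pos h]
    rw [hVi h1 hy (h2.trans hyz.symm)]
  have key : ∀ x ∈ Subtype.val '' S, ∃ f' : E n →L[ℝ] E n, HasFDerivAt τ f' x ∧
      g.sqrtDet d x = |f'.det| * g.sqrtDet c (τ x) := by
    rintro _ ⟨z, ⟨⟨_, y, hy, hyz⟩, _⟩, rfl⟩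
    obtain ⟨η, hη, hzs, hηz⟩ := O.exists_isTransition d.2 c.2 hyz.symm
    have hn : ∀ᶠ x in 𝓝 (z : E n), η x ∈ Subtype.val '' V :=
      (η.continuousAt hzs).eventually (by
        rw [hηz]
        exact (c.1.Uhat.isOpen.isOpenEmbedding_subtypeVal.isOpenMap V hV).mem_nhds ⟨y, hy, rfl⟩)
    have hev : τ =ᶠ[𝓝 (z : E n)] η := by
      filter_upwards [hn, η.open_source.mem_nhds hzs] with x hx hxs
      obtain ⟨w, hw, hwx⟩ := hx
      rw [← hwx]
      refine hτ ⟨x, hη.source_subset hxs⟩ w hw ?_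
      rw [← hη.proj_eq x hxs]
      congr 1
      exact Subtype.ext hwx
    refine ⟨fderiv ℝ η z, HasFDerivAt.congr_of_eventuallyEq
      ((hη.contDiffAt hzs).differentiableAt (by simp)).hasFDerivAt hev, ?_⟩
    rw [hev.self_of_nhds, ← g.sqrtDet_eq hη hzs]
  choose! f' hf' hdens using key
  have hinj : InjOn τ (Subtype.val '' S) := by
    rintro _ ⟨z, ⟨⟨_, y, hy, hyz⟩, hzW⟩, rfl⟩ _ ⟨z', ⟨⟨_, y', hy', hyz'⟩, hzW'⟩, rfl⟩ h
    rw [hτ z y hy hyz, hτ z' y' hy' hyz'] at h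
    rw [hWi hzW hzW' (by rw [← hyz, ← hyz', Subtype.ext h])]
  have hSm : MeasurableSet (Subtype.val '' S) :=
    (measurableEmbedding_coe d).measurableSet_image.2 hS
  have himg : τ '' (Subtype.val '' S) ⊆ Subtype.val '' (c.1.proj ⁻¹' A ∩ V) := by
    rintro _ ⟨_, ⟨z, ⟨⟨hzA, y, hy, hyz⟩, _⟩, rfl⟩, rfl⟩
    rw [hτ z y hy hyz]
    refine ⟨y, ⟨?_, hy⟩, rfl⟩
    rw [mem_preimage, hyz]
    exact hzA
  calc ∫⁻ x in Subtype.val '' S, ENNReal.ofReal (g.sqrtDet d x)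
      = ∫⁻ x in Subtype.val '' S,
          ENNReal.ofReal |(f' x).det| * ENNReal.ofReal (g.sqrtDet c (τ x)) := by
        refine setLIntegral_congr_fun hSm fun x hx => ?_
        rw [hdens x hx, ENNReal.ofReal_mul (abs_nonneg _)]
    _ = ∫⁻ x in τ '' (Subtype.val '' S), ENNReal.ofReal (g.sqrtDet c x) :=
        (lintegral_image_eq_lintegral_abs_det_fderiv_mul volume hSm
          (fun x hx => (hf' x hx).hasFDerivWithinAt) hinj
          fun x => ENNReal.ofReal (g.sqrtDet c x)).symm
    _ ≤ _ := lintegral_mono_set himg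

/-- On a coordinate patch, the Riemannian volume is `√det(g_ij) dx`. -/
theorem vol_restrict_image (c : O.charts) {V : Set c.1.Uhat} (hV : IsOpen V)
    (hVi : InjOn c.1.proj V) : g.vol.restrict (c.1.proj '' V) = g.patchMeasure c V := by
  have hPV : MeasurableSet (c.1.proj '' V) := (c.1.isOpenMap_proj V hV).measurableSet
  have hself : (g.patchMeasure c V).restrict (c.1.proj '' V) = g.patchMeasure c V := by
    ext A hA
    rw [Measure.restrict_apply hA, g.patchMeasure_apply c hV hA,
      g.patchMeasure_apply c hV (hA.inter hPV)]
    congr 1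
    ext y
    simp only [mem_inter_iff, mem_preimage]
    exact ⟨fun h => ⟨h.1.1, h.2⟩, fun h => ⟨⟨h.1, mem_image_of_mem _ h.2⟩, h.2⟩⟩
  apply le_antisymm
  · have hle : g.vol ≤ g.patchMeasure c V + g.vol.restrict (c.1.proj '' V)ᶜ := by
      refine iSup_le fun d => iSup_le fun W => iSup_le fun hW => ?_
      calc g.patchMeasure d W = (g.patchMeasure d W).restrict (c.1.proj '' V) +
            (g.patchMeasure d W).restrict (c.1.proj '' V)ᶜ :=
            (Measure.restrict_add_restrict_compl hPV).symm
        _ ≤ _ := add_le_add (g.restrict_patchMeasure_le c d hV hVi hW.1 hW.2)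
            (Measure.restrict_mono_measure (g.patchMeasure_le_vol d hW.1 hW.2) _)
    calc g.vol.restrict (c.1.proj '' V)
        ≤ (g.patchMeasure c V + g.vol.restrict (c.1.proj '' V)ᶜ).restrict (c.1.proj '' V) :=
          Measure.restrict_mono_measure hle _
      _ = g.patchMeasure c V := by
          rw [Measure.restrict_add, hself, Measure.restrict_restrict hPV, inter_compl_self,
            Measure.restrict_empty, add_zero]
  · calc g.patchMeasure c V = (g.patchMeasure c V).restrict (c.1.proj '' V) := hself.symm
      _ ≤ _ := Measure.restrict_mono_measure (g.patchMeasure_le_vol c hV hVi) _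

/-- Over the domain of a chart, the projection of the Riemannian measure of `Û` is the
Riemannian volume of the regular part, multiplied by the order of `Γ`. -/
theorem map_chartMeasure (c : O.charts) :
    (g.chartMeasure c).map c.1.proj =
      (Nat.card c.1.Γ : ENNReal) • g.vol.restrict ((c.1.U : Set M) ∩ O.singularSetᶜ) := by
  classical
  have hcm : Measurable c.1.proj := c.1.continuous_proj.measurable
  have hR : MeasurableSet ((c.1.U : Set M) ∩ O.singularSetᶜ) :=
    (c.1.U.isOpen.inter O.isOpen_compl_singularSet).measurableSet
  have hpre : c.1.proj ⁻¹' ((c.1.U : Set M) ∩ O.singularSetᶜ) = c.1.free := by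
    rw [preimage_inter, O.preimage_compl_singularSet c.2, inter_eq_right]
    exact fun y _ => c.1.proj_mem y
  have hL : (g.chartMeasure c).map c.1.proj =
      ((g.chartMeasure c).map c.1.proj).restrict ((c.1.U : Set M) ∩ O.singularSetᶜ) := by
    refine (Measure.restrict_eq_self_of_ae_mem ?_).symm
    rw [ae_iff]
    change ((g.chartMeasure c).map c.1.proj) ((c.1.U : Set M) ∩ O.singularSetᶜ)ᶜ = 0
    rw [Measure.map_apply hcm hR.compl, preimage_compl, hpre, g.chartMeasure_compl_free c]
  choose! V hVo hyV hVd using fun y (hy : y ∈ c.1.free) => c.1.exists_isOpen_disjoint hy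
  obtain ⟨T, hTc, hT⟩ := isOpen_iUnion_countable (fun y : c.1.free => V y) fun y => hVo y y.2
  have hinj : ∀ y ∈ c.1.free, ∀ γ : c.1.Γ, InjOn c.1.proj ((fun z => γ • z) ⁻¹' V y) := by
    intro y hy γ z hz w hw hzw
    obtain ⟨δ, rfl⟩ := c.1.proj_eq_iff.1 hzw
    have hz' : γ • δ • w ∈ V y := hz
    have hw' : γ • w ∈ V y := hw
    have := hVd y hy (γ • w) hw' (γ * δ * γ⁻¹) (by
      rwa [mul_smul, inv_smul_smul, mul_smul])
    have hδ : δ = γ⁻¹ * (γ * δ * γ⁻¹) * γ := by group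
    rw [this] at hδ
    have : δ = 1 := by rw [hδ]; group
    rw [this, one_smul]
  have hopen : ∀ y ∈ c.1.free, ∀ γ : c.1.Γ, IsOpen ((fun z => γ • z) ⁻¹' V y) :=
    fun y hy γ => (hVo y hy).preimage (continuous_const_smul γ)
  have himg : ∀ (y : c.1.Uhat) (γ : c.1.Γ),
      c.1.proj '' ((fun z => γ • z) ⁻¹' V y) = c.1.proj '' V y := by
    intro y γ
    ext x
    constructor
    · rintro ⟨z, hz, rfl⟩
      exact ⟨γ • z, hz, c.1.proj_smul γ z⟩
    · rintro ⟨z, hz, rfl⟩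
      exact ⟨γ⁻¹ • z, by simpa using hz, c.1.proj_smul γ⁻¹ z⟩
  have hcover : (c.1.U : Set M) ∩ O.singularSetᶜ ⊆ ⋃ y ∈ T, c.1.proj '' V (y : c.1.Uhat) := by
    rw [← O.image_free c.2]
    rintro _ ⟨y, hy, rfl⟩
    have : y ∈ ⋃ i ∈ T, V (i : c.1.Uhat) := by
      rw [hT]
      exact mem_iUnion.2 ⟨⟨y, hy⟩, hyV y hy⟩
    obtain ⟨i, hi, hyi⟩ := mem_iUnion₂.1 this
    exact mem_iUnion₂.2 ⟨i, hi, y, hyi, rfl⟩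
  have hmain : ((g.chartMeasure c).map c.1.proj).restrict
      (⋃ y ∈ T, c.1.proj '' V (y : c.1.Uhat)) =
      ((Nat.card c.1.Γ : ENNReal) • g.vol).restrict (⋃ y ∈ T, c.1.proj '' V (y : c.1.Uhat)) := by
    rw [Measure.restrict_biUnion_congr hTc]
    rintro ⟨y, hy⟩ -
    have hPV : MeasurableSet (c.1.proj '' V y) :=
      (c.1.isOpenMap_proj _ (hVo y hy)).measurableSet
    ext A hA
    rw [Measure.restrict_apply hA, Measure.map_apply hcm (hA.inter hPV), Measure.restrict_smul,
      Measure.smul_apply]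
    have hdec : c.1.proj ⁻¹' (A ∩ c.1.proj '' V y) =
        ⋃ γ : c.1.Γ, (c.1.proj ⁻¹' A ∩ (fun z => γ • z) ⁻¹' V y) := by
      ext z
      simp only [mem_iUnion, mem_inter_iff, mem_preimage, exists_and_left]
      refine and_congr_right fun _ => ⟨?_, ?_⟩
      · rintro ⟨w, hw, hwz⟩
        obtain ⟨γ, rfl⟩ := c.1.proj_eq_iff.1 hwz
        exact ⟨γ, hw⟩
      · rintro ⟨γ, hγ⟩
        exact ⟨γ • z, hγ, c.1.proj_smul γ z⟩
    have hdisj : Pairwise (Function.onFun Disjoint fun γ : c.1.Γ =>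
        (c.1.proj ⁻¹' A ∩ (fun z => γ • z) ⁻¹' V y)) := by
      intro γ δ hγδ
      refine disjoint_left.2 fun z hz hz' => hγδ ?_
      have h1 : γ • z ∈ V y := hz.2
      have h2 : δ • z ∈ V y := hz'.2
      have := hVd y hy (δ • z) h2 (γ * δ⁻¹) (by rwa [mul_smul, inv_smul_smul])
      exact mul_inv_eq_one.1 this
    have hms : ∀ γ : c.1.Γ, MeasurableSet (c.1.proj ⁻¹' A ∩ (fun z => γ • z) ⁻¹' V y) :=
      fun γ => (hcm hA).inter (hopen y hy γ).measurableSet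
    have heach : ∀ γ : c.1.Γ, g.chartMeasure c (c.1.proj ⁻¹' A ∩ (fun z => γ • z) ⁻¹' V y) =
        g.vol.restrict (c.1.proj '' V y) A := by
      intro γ
      rw [← g.patchMeasure_apply c (hopen y hy γ) hA,
        ← g.vol_restrict_image c (hopen y hy γ) (hinj y hy γ), himg]
    rw [hdec, measure_iUnion hdisj hms]
    simp_rw [heach]
    have := Fintype.ofFinite c.1.Γ
    rw [tsum_fintype, Finset.sum_const, Finset.card_univ, Nat.card_eq_fintype_card,
      nsmul_eq_mul, smul_eq_mul]
  rw [hL, ← Measure.restrict_smul]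
  have := congrArg (fun μ : Measure M => μ.restrict ((c.1.U : Set M) ∩ O.singularSetᶜ)) hmain
  simpa only [Measure.restrict_restrict hR, inter_eq_left.2 hcover] using this

/-- Integrals over the regular part of functions supported over a chart, computed in the chart. -/
theorem integral_vol_eq (c : O.charts) {f : M → ℝ} {F : E n → ℝ}
    (hfF : ∀ y ∈ c.1.free, f (c.1.proj y) = F y)
    (hf0 : ∀ x ∈ O.singularSetᶜ, x ∉ c.1.U → f x = 0)
    (hFc : ContinuousOn F c.1.Uhat)
    (hF : IntegrableOn (fun x => g.sqrtDet c x * F x) c.1.Uhat) :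
    IntegrableOn f O.singularSetᶜ g.vol ∧
      (Nat.card c.1.Γ : ℝ) * ∫ x in O.singularSetᶜ, f x ∂g.vol =
        ∫ x in (c.1.Uhat : Set (E n)), g.sqrtDet c x * F x := by
  set R : Set M := (c.1.U : Set M) ∩ O.singularSetᶜ with hRdef
  have hS : MeasurableSet O.singularSetᶜ := O.isOpen_compl_singularSet.measurableSet
  have hR : MeasurableSet R := (c.1.U.isOpen.inter O.isOpen_compl_singularSet).measurableSet
  have hcard : (Nat.card c.1.Γ : ENNReal) ≠ 0 := by exact_mod_cast Nat.card_pos.ne'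
  have hcm : Measurable c.1.proj := c.1.continuous_proj.measurable
  have hmap := g.map_chartMeasure c
  have hfc : ContinuousOn f R := by
    rw [hRdef, ← O.image_free c.2]
    rintro _ ⟨y, hy, rfl⟩
    refine ContinuousAt.continuousWithinAt ?_
    have hFy : ContinuousAt (fun z : c.1.Uhat => F z) y :=
      (continuousOn_iff_continuous_domRestrict.1 hFc).continuousAt
    have hcomp : Filter.Tendsto (f ∘ c.1.proj) (𝓝 y) (𝓝 (f (c.1.proj y))) := by
      rw [hfF y hy]
      refine Filter.Tendsto.congr' ?_ hFy
      filter_upwards [c.1.isOpen_free.mem_nhds hy] with z hz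
      exact (hfF z hz).symm
    have hnh : Filter.map c.1.proj (𝓝 y) = 𝓝 (c.1.proj y) :=
      le_antisymm c.1.continuous_proj.continuousAt (c.1.isOpenMap_proj.nhds_le y)
    change Filter.Tendsto f _ _
    rw [← hnh]
    exact Filter.tendsto_map'_iff.2 hcomp
  have hae : (fun y : c.1.Uhat => f (c.1.proj y)) =ᵐ[g.chartMeasure c]
      fun y => F y := by
    have : ∀ᵐ y ∂(g.chartMeasure c), y ∈ c.1.free := by
      rw [ae_iff]
      exact g.chartMeasure_compl_free c
    filter_upwards [this] with y hy
    exact hfF y hy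
  have hmeas : Measurable fun y : c.1.Uhat => (g.sqrtDet c y).toNNReal :=
    (g.continuous_sqrtDet c).measurable.real_toNNReal
  have hnn : ∀ y : c.1.Uhat, (g.sqrtDet c y).toNNReal • F y = g.sqrtDet c y * F y := fun y => by
    rw [NNReal.smul_def, Real.coe_toNNReal (g.sqrtDet c y) (Real.sqrt_nonneg _), smul_eq_mul]
  have hsm : AEStronglyMeasurable f ((g.chartMeasure c).map c.1.proj) := by
    rw [hmap]
    exact AEStronglyMeasurable.smul_measure (hfc.aestronglyMeasurable hR) _
  have hint : Integrable (fun y : c.1.Uhat => F y) (g.chartMeasure c) := by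
    refine (integrable_withDensity_iff_integrable_smul hmeas).2 ?_
    simp_rw [hnn]
    exact ((measurableEmbedding_coe c).integrableOn_range_iff_comap).1 (by
      rwa [Subtype.range_coe])
  have hint2 : Integrable f ((g.chartMeasure c).map c.1.proj) :=
    (integrable_map_measure hsm hcm.aemeasurable).2 (hint.congr hae.symm)
  have hIR : IntegrableOn f R g.vol := by
    rw [hmap] at hint2
    exact (integrable_smul_measure hcard (ENNReal.natCast_ne_top _)).1 hint2
  have hdiff : ∀ x ∈ O.singularSetᶜ \ R, f x = 0 := fun x hx =>
    hf0 x hx.1 fun h => hx.2 ⟨h, hx.1⟩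
  refine ⟨hIR.of_forall_sdiff_eq_zero hS hdiff, ?_⟩
  rw [setIntegral_eq_of_subset_of_forall_sdiff_eq_zero hS inter_subset_right hdiff]
  have h1 : ∫ x, f x ∂((g.chartMeasure c).map c.1.proj) =
      (Nat.card c.1.Γ : ℝ) * ∫ x in R, f x ∂g.vol := by
    rw [hmap, integral_smul_measure, ENNReal.toReal_natCast, smul_eq_mul]
  rw [← h1, integral_map hcm.aemeasurable hsm, integral_congr_ae hae]
  unfold chartMeasure
  refine (integral_withDensity_eq_integral_smul hmeas _).trans ?_
  simp_rw [hnn]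
  exact integral_subtype_comap c.1.Uhat.isOpen.measurableSet fun x => g.sqrtDet c x * F x

end RiemannianMetric

end Orbifold

end Orbi

namespace Orbi

namespace Orbifold

variable {n : ℕ} {M : Type*} [TopologicalSpace M]

/-! ### Differentiable functions on an orbifold -/

open Classical in
/-- The function `h ∘ φ⁻¹ ∘ π_Γ` on `Û`, extended by zero. -/
noncomputable def pullback (h : M → ℝ) (c : OrbifoldChart n M) (x : E n) : ℝ :=
  if hx : x ∈ c.Uhat then h (c.proj ⟨x, hx⟩) else 0

theorem pullback_coe (h : M → ℝ) (c : OrbifoldChart n M) (y : c.Uhat) :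
    pullback h c y = h (c.proj y) := by
  simp [pullback]

theorem pullback_of_notMem (h : M → ℝ) (c : OrbifoldChart n M) {x : E n} (hx : x ∉ c.Uhat) :
    pullback h c x = 0 := by
  simp [pullback, hx]

theorem pullback_eventuallyEq (h : M → ℝ) {c d : OrbifoldChart n M}
    {η : OpenPartialHomeomorph (E n) (E n)} (hη : IsTransition c d η) {x : E n}
    (hx : x ∈ η.source) : pullback h c =ᶠ[𝓝 x] pullback h d ∘ η := by
  filter_upwards [η.open_source.mem_nhds hx] with z hz
  have h1 := pullback_coe h c ⟨z, hη.source_subset hz⟩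
  have h2 := pullback_coe h d ⟨η z, hη.target_subset (η.map_source hz)⟩
  rw [hη.proj_eq z hz] at h2
  exact h1.trans h2.symm

variable {O : Orbifold n M}

/-- A function on `M` of class `C¹`: so are its pullbacks to all charts of the atlas. -/
def IsC1 (O : Orbifold n M) (h : M → ℝ) : Prop :=
  ∀ c ∈ O.charts, ContDiffOn ℝ 1 (pullback h c) c.Uhat

theorem IsC1.continuous {h : M → ℝ} (hh : O.IsC1 h) : Continuous h := by
  refine continuous_iff_continuousAt.2 fun x => ?_
  obtain ⟨c, hc, hx⟩ := O.cover x
  obtain ⟨y, rfl⟩ := c.exists_proj_eq hx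
  have h1 : Continuous (h ∘ c.proj) :=
    (continuousOn_iff_continuous_domRestrict.1 (hh c hc).continuousOn).congr
      fun z => pullback_coe h c z
  have hnh : Filter.map c.proj (𝓝 y) = 𝓝 (c.proj y) :=
    le_antisymm c.continuous_proj.continuousAt (c.isOpenMap_proj.nhds_le y)
  change Filter.Tendsto h _ _
  rw [← hnh]
  exact Filter.tendsto_map'_iff.2 h1.continuousAt

theorem IsC1.sum {ι : Type*} {t : Finset ι} {h : ι → M → ℝ} (hh : ∀ i ∈ t, O.IsC1 (h i)) :
    O.IsC1 fun x => ∑ i ∈ t, h i x := by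
  intro c hc
  refine (ContDiffOn.sum fun i hi => hh i hi c hc).congr fun x hx => ?_
  simp [pullback, show x ∈ c.Uhat from hx]

theorem IsC1.div {h h' : M → ℝ} (hh : O.IsC1 h) (hh' : O.IsC1 h') (h0 : ∀ x, h' x ≠ 0) :
    O.IsC1 fun x => h x / h' x := by
  intro c hc
  refine ((hh c hc).div (hh' c hc) fun x hx => ?_).congr fun x hx => ?_
  · rw [pullback_coe h' c ⟨x, hx⟩]
    exact h0 _
  · simp [pullback, show x ∈ c.Uhat from hx]

/-- `h` vanishes off the image of a compact subset of `Û`. -/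
def SupportedIn (h : M → ℝ) (c : OrbifoldChart n M) : Prop :=
  ∃ K : Set (E n), IsCompact K ∧ K ⊆ c.Uhat ∧ (∀ x ∉ c.U, h x = 0) ∧
    ∀ y : c.Uhat, (y : E n) ∉ K → h (c.proj y) = 0

theorem SupportedIn.isClosed_image [T2Space M] (c : OrbifoldChart n M) {K : Set (E n)}
    (hK : IsCompact K) (hKU : K ⊆ c.Uhat) : IsClosed (c.proj '' (Subtype.val ⁻¹' K)) := by
  refine IsCompact.isClosed (IsCompact.image ?_ c.continuous_proj)
  exact (Topology.IsInducing.subtypeVal.isCompact_preimage_iff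
    (by simpa [Subtype.range_coe] using hKU)).2 hK

/-- Around each point there is a `C¹` bump function supported in a given chart. -/
theorem exists_bump [T2Space M] {c : OrbifoldChart n M} (hc : c ∈ O.charts) (y : c.Uhat) :
    ∃ χ : M → ℝ, O.IsC1 χ ∧ (∀ x, 0 ≤ χ x) ∧ 0 < χ (c.proj y) ∧ SupportedIn χ c := by
  classical
  have := Fintype.ofFinite c.Γ
  obtain ⟨f, hfs, hfc, hf, hfr, hfy⟩ :=
    exists_contDiff_tsupport_subset (n := 1) (c.Uhat.isOpen.mem_nhds y.2)
  have hf0 : ∀ x, 0 ≤ f x := fun x => (hfr (mem_range_self x)).1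
  let χ : M → ℝ := fun x =>
    if hx : x ∈ c.U then ∑ γ : c.Γ, f (γ • (c.exists_proj_eq hx).choose : c.Uhat) else 0
  have hχ : ∀ z : c.Uhat, χ (c.proj z) = ∑ γ : c.Γ, f (γ • z : c.Uhat) := by
    intro z
    have hz := c.proj_mem z
    obtain ⟨δ, hδ⟩ := c.proj_eq_iff.1 (c.exists_proj_eq hz).choose_spec
    simp only [χ, dif_pos hz]
    rw [← hδ]
    simp_rw [smul_smul]
    exact Fintype.sum_equiv (Equiv.mulRight δ) _ _ fun γ => rfl
  have hχ0 : ∀ x ∉ c.U, χ x = 0 := fun x hx => by simp [χ, hx]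
  set K₀ : Set c.Uhat := Subtype.val ⁻¹' tsupport f
  have hK₀ : IsCompact K₀ := (Topology.IsInducing.subtypeVal.isCompact_preimage_iff
    (by simpa [Subtype.range_coe] using hfs)).2 hfc
  have hfK : ∀ z : c.Uhat, z ∉ K₀ → f z = 0 := fun z hz => image_eq_zero_of_notMem_tsupport hz
  have hcl : IsClosed (c.proj '' K₀) := SupportedIn.isClosed_image c hfc hfs
  have hχcl : ∀ x ∉ c.proj '' K₀, χ x = 0 := by
    intro x hx
    by_cases hxU : x ∈ c.U
    · obtain ⟨z, rfl⟩ := c.exists_proj_eq hxU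
      rw [hχ]
      refine Finset.sum_eq_zero fun γ _ => hfK _ fun hz => hx ⟨_, hz, c.proj_smul γ z⟩
    · exact hχ0 x hxU
  refine ⟨χ, ?_, ?_, ?_, ?_⟩
  · intro d hd x hx
    refine ContDiffAt.contDiffWithinAt ?_
    by_cases hxC : d.proj ⟨x, hx⟩ ∈ c.proj '' K₀
    · obtain ⟨w, -, hw⟩ := hxC
      obtain ⟨η, hη, hxs, hηx⟩ := O.exists_isTransition (y := ⟨x, hx⟩) hd hc hw.symm
      refine ContDiffAt.congr_of_eventuallyEq ?_ (pullback_eventuallyEq χ hη hxs)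
      refine ContDiffAt.comp x ?_ ((hη.contDiffAt hxs).of_le (by simp))
      rw [hηx]
      choose a ha has hav using fun γ => exists_isTransition_smul c γ
      have hev : pullback χ c =ᶠ[𝓝 (w : E n)] fun z => ∑ γ, f (a γ z) := by
        filter_upwards [c.Uhat.isOpen.mem_nhds w.2] with z hz
        rw [pullback_coe χ c ⟨z, hz⟩, hχ]
        exact Finset.sum_congr rfl fun γ _ => by rw [← hav]
      refine ContDiffAt.congr_of_eventuallyEq (ContDiffAt.sum fun γ _ => ?_) hev
      exact hf.contDiffAt.comp _ (((ha γ).contDiffAt (has γ ▸ w.2)).of_le (by simp))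
    · have hev : pullback χ d =ᶠ[𝓝 x] fun _ => 0 := by
        have ho : IsOpen (Subtype.val '' (d.proj ⁻¹' (c.proj '' K₀)ᶜ)) :=
          d.Uhat.isOpen.isOpenEmbedding_subtypeVal.isOpenMap _
            (hcl.isOpen_compl.preimage d.continuous_proj)
        filter_upwards [ho.mem_nhds ⟨⟨x, hx⟩, hxC, rfl⟩] with z hz
        obtain ⟨w, hw, rfl⟩ := hz
        rw [pullback_coe]
        exact hχcl _ hw
      exact contDiffAt_const.congr_of_eventuallyEq hev
  · intro x
    by_cases hx : x ∈ c.U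
    · simp only [χ, dif_pos hx]
      exact Finset.sum_nonneg fun γ _ => hf0 _
    · exact (hχ0 x hx).ge
  · rw [hχ]
    refine Finset.sum_pos' (fun γ _ => hf0 _) ⟨1, Finset.mem_univ _, ?_⟩
    rw [one_smul, hfy]
    exact one_pos
  · refine ⟨⋃ γ : c.Γ, Subtype.val '' ((fun z => γ • z) '' K₀), ?_, ?_, hχ0, ?_⟩
    · exact isCompact_iUnion fun γ =>
        (hK₀.image (continuous_const_smul γ)).image continuous_subtype_val
    · refine iUnion_subset fun γ => ?_
      rintro _ ⟨z, _, rfl⟩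
      exact z.2
    · intro z hz
      rw [hχ]
      refine Finset.sum_eq_zero fun γ _ => hfK _ fun hγ => hz ?_
      exact mem_iUnion.2 ⟨γ⁻¹, z, ⟨γ • z, hγ, inv_smul_smul γ z⟩, rfl⟩

/-- A `C¹` partition of unity subordinate to finitely many charts. -/
theorem exists_partition [T2Space M] [CompactSpace M] (O : Orbifold n M) :
    ∃ (t : Finset M) (c : M → O.charts) (h : M → M → ℝ), (∀ i, O.IsC1 (h i)) ∧
      (∀ i, SupportedIn (h i) (c i).1) ∧ ∀ x, ∑ i ∈ t, h i x = 1 := by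
  have key : ∀ x : M, ∃ (c : O.charts) (χ : M → ℝ), O.IsC1 χ ∧ (∀ x, 0 ≤ χ x) ∧ 0 < χ x ∧
      SupportedIn χ c.1 := by
    intro x
    obtain ⟨⟨c, y⟩, rfl⟩ := O.exists_proj_eq x
    obtain ⟨χ, h⟩ := exists_bump c.2 y
    exact ⟨c, χ, h⟩
  choose c χ hC hnn hpos hsupp using key
  obtain ⟨t, ht⟩ := isCompact_univ.elim_finite_subcover (fun i => {x | 0 < χ i x})
    (fun i => isOpen_lt continuous_const (hC i).continuous)
    (fun x _ => mem_iUnion.2 ⟨x, hpos x⟩)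
  have hS : ∀ x, 0 < ∑ i ∈ t, χ i x := by
    intro x
    obtain ⟨i, hi, hx⟩ := mem_iUnion₂.1 (ht (mem_univ x))
    exact Finset.sum_pos' (fun j _ => hnn j x) ⟨i, hi, hx⟩
  refine ⟨t, c, fun i x => χ i x / ∑ j ∈ t, χ j x,
    fun i => (hC i).div (IsC1.sum fun j _ => hC j) fun x => (hS x).ne', fun i => ?_, fun x => ?_⟩
  · obtain ⟨K, hK, hKU, h1, h2⟩ := hsupp i
    exact ⟨K, hK, hKU, fun x hx => by simp [h1 x hx],
      fun y hy => by simp [h2 y hy]⟩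
  · rw [← Finset.sum_div, div_self (hS x).ne']

/-! ### Divergence and directional derivatives in a chart -/

/-- The derivative of a function in the direction of an orbitangent vector field. -/
noncomputable def VectorField.deriv {l : ℕ∞} (X : O.VectorField l) (h : M → ℝ) (x : M) : ℝ :=
  let p := (O.exists_proj_eq x).choose
  fderiv ℝ (pullback h p.1.1) p.2 (X.lift p.1 p.2)

section Chart

variable {k : ℕ∞} (X : O.VectorField 1)

theorem VectorField.differentiableAt_lift (c : O.charts) {x : E n} (hx : x ∈ c.1.Uhat) :
    DifferentiableAt ℝ (X.lift c) x :=
  ((X.contDiffOn_lift c).contDiffAt (c.1.Uhat.isOpen.mem_nhds hx)).differentiableAt one_ne_zero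

theorem VectorField.deriv_proj {h : M → ℝ} (hh : O.IsC1 h) (c : O.charts) {y : c.1.Uhat}
    (hy : y ∈ c.1.free) :
    X.deriv h (c.1.proj y) = fderiv ℝ (pullback h c.1) y (X.lift c y) := by
  set p := (O.exists_proj_eq (c.1.proj y)).choose with hp
  have hpe : p.1.1.proj p.2 = c.1.proj y := (O.exists_proj_eq (c.1.proj y)).choose_spec
  obtain ⟨η, hη, hys, hηy⟩ := O.exists_isTransition c.2 p.1.2 hpe.symm
  change fderiv ℝ (pullback h p.1.1) p.2 (X.lift p.1 p.2) = _
  have hd : DifferentiableAt ℝ (pullback h p.1.1) (η y) := by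
    rw [hηy]
    exact ((hh p.1.1 p.1.2).contDiffAt (p.1.1.Uhat.isOpen.mem_nhds p.2.2)).differentiableAt
      one_ne_zero
  rw [(pullback_eventuallyEq h hη hys).fderiv_eq,
    fderiv_comp _ hd ((hη.contDiffAt hys).differentiableAt (by simp)),
    ContinuousLinearMap.comp_apply, X.fderiv_lift hη hy hys, hηy]

theorem RiemannianMetric.differentiableAt_lift (hk : 1 ≤ k) (g : O.RiemannianMetric k)
    (c : O.charts) {x : E n} (hx : x ∈ c.1.Uhat) : DifferentiableAt ℝ (g.lift c) x :=
  ((g.contDiffOn c).contDiffAt (c.1.Uhat.isOpen.mem_nhds hx)).differentiableAt (by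
    have : k ≠ 0 := by
      rintro rfl
      exact absurd hk (by decide)
    exact_mod_cast this)

theorem RiemannianMetric.eventually_symm (g : O.RiemannianMetric k) (c : O.charts) {x : E n}
    (hx : x ∈ c.1.Uhat) : ∀ᶠ y in 𝓝 x, ∀ v w, g.lift c y v w = g.lift c y w v := by
  filter_upwards [c.1.Uhat.isOpen.mem_nhds hx] with y hy
  exact g.symm c y hy

theorem div_proj (hk : 1 ≤ k) (g : O.RiemannianMetric k) (c : O.charts) {y : c.1.Uhat}
    (hy : y ∈ c.1.free) :
    Orbifold.div g X (c.1.proj y) = localDiv (g.lift c) (X.lift c) y := by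
  set p := (O.exists_proj_eq (c.1.proj y)).choose with hp
  have hpe : p.1.1.proj p.2 = c.1.proj y := (O.exists_proj_eq (c.1.proj y)).choose_spec
  obtain ⟨η, hη, hys, hηy⟩ := O.exists_isTransition c.2 p.1.2 hpe.symm
  change localDiv (g.lift p.1) (X.lift p.1) p.2 = _
  have hηU : η y ∈ p.1.1.Uhat := hηy ▸ p.2.2
  have hB : fderiv ℝ η.symm (η y) ∘L fderiv ℝ η y = .id ℝ _ := by
    rw [← fderiv_comp _ ((hη.symm.contDiffAt (η.map_source hys)).differentiableAt (by simp))
      ((hη.contDiffAt hys).differentiableAt (by simp))]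
    have : η.symm ∘ η =ᶠ[𝓝 (y : E n)] id := by
      filter_upwards [η.open_source.mem_nhds hys] with x hx
      exact η.left_inv hx
    rw [this.fderiv_eq, fderiv_id]
  have hfree : Subtype.val '' c.1.free ∈ 𝓝 (y : E n) :=
    (c.1.Uhat.isOpen.isOpenEmbedding_subtypeVal.isOpenMap _ c.1.isOpen_free).mem_nhds
      ⟨y, hy, rfl⟩
  have := localDiv_pullback (hη.contDiffAt hys) hB (g.differentiableAt_lift hk c y.2)
    (X.differentiableAt_lift c y.2) (g.eventually_symm c y.2) (g.pos c y y.2)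
    (g.differentiableAt_lift hk p.1 hηU) (X.differentiableAt_lift p.1 hηU)
    (g.eventually_symm p.1 hηU) (g.pos p.1 _ hηU)
    (by
      filter_upwards [η.open_source.mem_nhds hys] with x hx
      exact g.compat c p.1 η hη x hx)
    (by
      filter_upwards [η.open_source.mem_nhds hys, hfree] with x hx hxf
      obtain ⟨z, hz, rfl⟩ := hxf
      exact X.fderiv_lift hη hz hx)
  rw [this, hηy]

theorem continuousOn_localDiv (hk : 1 ≤ k) (g : O.RiemannianMetric k) (c : O.charts) :
    ContinuousOn (localDiv (g.lift c) (X.lift c)) c.1.Uhat := by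
  have hVD : ContinuousOn (fderiv ℝ (X.lift c)) c.1.Uhat :=
    (X.contDiffOn_lift c).continuousOn_fderiv_of_isOpen c.1.Uhat.isOpen le_rfl
  have hGD : ContinuousOn (fderiv ℝ fun x => (metricMatrix (g.lift c) x).det) c.1.Uhat :=
    (g.contDiffOn_metricMatrix_det c).continuousOn_fderiv_of_isOpen c.1.Uhat.isOpen
      (by exact_mod_cast hk)
  have hG := (g.contDiffOn_metricMatrix_det c).continuousOn
  have hV := (X.contDiffOn_lift c).continuousOn
  have htr : ContinuousOn (fun x => (toMat (fderiv ℝ (X.lift c) x)).trace) c.1.Uhat := by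
    change ContinuousOn (fun x => ∑ i, fderiv ℝ (X.lift c) x (basisVec i) i) _
    fun_prop
  refine (htr.add ((hGD.clm_apply hV).div (continuousOn_const.mul hG) fun x hx => ?_)).congr
    fun x hx => localDiv_eq (g.differentiableAt_lift hk c hx) (X.differentiableAt_lift c hx)
      (g.eventually_symm c hx) (g.pos c x hx)
  exact mul_ne_zero two_ne_zero (g.posDef c hx).det_pos.ne'

end Chart

/-! ### The divergence theorem -/

theorem integrableOn_of_continuousOn_of_compact {U K : Set (E n)} {F : E n → ℝ} (hU : IsOpen U)
    (hK : IsCompact K) (hKU : K ⊆ U) (hF : ContinuousOn F U) (h0 : ∀ x ∈ U, x ∉ K → F x = 0) :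
    IntegrableOn F U :=
  ((hF.mono hKU).integrableOn_compact hK).of_forall_sdiff_eq_zero hU.measurableSet
    fun x hx => h0 x hx.1 hx.2

variable {k : ℕ∞} [T2Space M] [MeasurableSpace M] [BorelSpace M]

/-- Integration by parts against a function supported in a chart. -/
theorem integral_mul_div_add_integral_deriv (hk : 1 ≤ k) (g : O.RiemannianMetric k)
    (X : O.VectorField 1) {h : M → ℝ} (hh : O.IsC1 h) (c : O.charts) (hc : SupportedIn h c.1) :
    IntegrableOn (fun x => h x * Orbifold.div g X x) O.singularSetᶜ g.vol ∧
      IntegrableOn (X.deriv h) O.singularSetᶜ g.vol ∧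
      ∫ x in O.singularSetᶜ, h x * Orbifold.div g X x ∂g.vol +
        ∫ x in O.singularSetᶜ, X.deriv h x ∂g.vol = 0 := by
  obtain ⟨K, hK, hKU, hU0, hK0⟩ := hc
  set U : Set (E n) := (c.1.Uhat : Set (E n)) with hUdef
  have hUo : IsOpen U := c.1.Uhat.isOpen
  set f := pullback h c.1 with hf
  have hfC : ContDiffOn ℝ 1 f U := hh c.1 c.2
  have hf0 : ∀ x ∉ K, f x = 0 := by
    intro x hx
    by_cases hxU : x ∈ c.1.Uhat
    · rw [hf, pullback_coe h c.1 ⟨x, hxU⟩, hK0 ⟨x, hxU⟩ hx]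
    · exact pullback_of_notMem h c.1 hxU
  have hev0 : ∀ x ∉ K, f =ᶠ[𝓝 x] fun _ => 0 := by
    intro x hx
    filter_upwards [hK.isClosed.isOpen_compl.mem_nhds hx] with z hz
    exact hf0 z hz
  have hfd0 : ∀ x ∉ K, fderiv ℝ f x = 0 := by
    intro x hx
    rw [(hev0 x hx).fderiv_eq]
    simp
  have hsC : ContDiffOn ℝ 1 (g.sqrtDet c) U :=
    (g.contDiffOn_sqrtDet c).of_le (by exact_mod_cast hk)
  have hVC := X.contDiffOn_lift c
  have hF1c : ContinuousOn (fun x => f x * localDiv (g.lift c) (X.lift c) x) U :=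
    hfC.continuousOn.mul (continuousOn_localDiv X hk g c)
  have hF2c : ContinuousOn (fun x => fderiv ℝ f x (X.lift c x)) U :=
    (hfC.continuousOn_fderiv_of_isOpen hUo le_rfl).clm_apply hVC.continuousOn
  have hI1 : IntegrableOn
      (fun x => g.sqrtDet c x * (f x * localDiv (g.lift c) (X.lift c) x)) U :=
    integrableOn_of_continuousOn_of_compact hUo hK hKU (hsC.continuousOn.mul hF1c)
      fun x _ hx => by rw [hf0 x hx, zero_mul, mul_zero]
  have hI2 : IntegrableOn (fun x => g.sqrtDet c x * fderiv ℝ f x (X.lift c x)) U :=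
    integrableOn_of_continuousOn_of_compact hUo hK hKU (hsC.continuousOn.mul hF2c)
      fun x _ hx => by rw [hfd0 x hx]; simp
  have hcl : IsClosed (c.1.proj '' (Subtype.val ⁻¹' K)) := SupportedIn.isClosed_image c.1 hK hKU
  have hhcl : ∀ x ∉ c.1.proj '' (Subtype.val ⁻¹' K), h x = 0 := by
    intro x hx
    by_cases hxU : x ∈ c.1.U
    · obtain ⟨z, rfl⟩ := c.1.exists_proj_eq hxU
      exact hK0 z fun hz => hx ⟨z, hz, rfl⟩
    · exact hU0 x hxU
  obtain ⟨hi1, he1⟩ := g.integral_vol_eq c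
    (f := fun x => h x * Orbifold.div g X x)
    (fun y hy => by rw [div_proj X hk g c hy, hf, pullback_coe])
    (fun x _ hx => by rw [hU0 x hx, zero_mul]) hF1c hI1
  obtain ⟨hi2, he2⟩ := g.integral_vol_eq c (f := X.deriv h)
    (fun y hy => X.deriv_proj hh c hy)
    (fun x hxS hx => by
      obtain ⟨⟨d, z⟩, rfl⟩ := O.exists_proj_eq x
      have hzf : z ∈ d.1.free := by
        have : z ∈ d.1.proj ⁻¹' O.singularSetᶜ := hxS
        rwa [O.preimage_compl_singularSet d.2] at this
      have hev : pullback h d.1 =ᶠ[𝓝 (z : E n)] fun _ => 0 := by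
        have ho : IsOpen (Subtype.val '' (d.1.proj ⁻¹' (c.1.proj '' (Subtype.val ⁻¹' K))ᶜ)) :=
          d.1.Uhat.isOpen.isOpenEmbedding_subtypeVal.isOpenMap _
            (hcl.isOpen_compl.preimage d.1.continuous_proj)
        filter_upwards [ho.mem_nhds ⟨z, by
          rintro ⟨w, _, hw⟩
          exact hx (hw ▸ c.1.proj_mem w), rfl⟩] with u hu
        obtain ⟨w, hw, rfl⟩ := hu
        rw [pullback_coe]
        exact hhcl _ hw
      rw [X.deriv_proj hh d hzf, hev.fderiv_eq]
      simp) hF2c hI2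
  refine ⟨hi1, hi2, ?_⟩
  let W : E n → E n := fun x => (f x * g.sqrtDet c x) • X.lift c x
  have hW0 : ∀ x ∉ K, W x = 0 := fun x hx => by simp [W, hf0 x hx]
  have hWev : ∀ x ∉ K, W =ᶠ[𝓝 x] fun _ => 0 := by
    intro x hx
    filter_upwards [hK.isClosed.isOpen_compl.mem_nhds hx] with z hz
    exact hW0 z hz
  have hWC : ContDiff ℝ 1 W := by
    refine contDiff_iff_contDiffAt.2 fun x => ?_
    by_cases hx : x ∈ U
    · exact ((hfC.mul hsC).smul hVC).contDiffAt (hUo.mem_nhds hx)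
    · exact contDiffAt_const.congr_of_eventuallyEq (hWev x fun h => hx (hKU h))
  have hzero := integral_trace_fderiv_eq_zero hWC (HasCompactSupport.intro hK hW0)
  have hUint : ∫ x in U, (toMat (fderiv ℝ W x)).trace = 0 := by
    rw [setIntegral_eq_integral_of_forall_compl_eq_zero, hzero]
    intro x hx
    rw [(hWev x fun h => hx (hKU h)).fderiv_eq]
    simp [toMat, Matrix.trace]
  have hsum : (∫ x in U, g.sqrtDet c x * (f x * localDiv (g.lift c) (X.lift c) x)) +
      ∫ x in U, g.sqrtDet c x * fderiv ℝ f x (X.lift c x) = 0 := by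
    rw [← integral_add hI1 hI2, ← hUint]
    refine setIntegral_congr_fun hUo.measurableSet fun x hx => ?_
    have := trace_fderiv_smul_sqrt_smul (g.differentiableAt_lift hk c hx)
      (X.differentiableAt_lift c hx)
      ((hfC.contDiffAt (hUo.mem_nhds hx)).differentiableAt one_ne_zero)
      (g.eventually_symm c hx) (g.pos c x hx)
    refine Eq.trans ?_ this.symm
    simp only [RiemannianMetric.sqrtDet]
    ring
  have hcard : (Nat.card c.1.Γ : ℝ) ≠ 0 := by exact_mod_cast Nat.card_pos.ne'
  refine (mul_eq_zero.1 ?_).resolve_left hcard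
  rw [mul_add, he1, he2, hsum]

end Orbifold

end Orbi

theorem theorem6p1 {n : ℕ} {M : Type*} [TopologicalSpace M] [T2Space M] [CompactSpace M]
    [MeasurableSpace M] [BorelSpace M] (O : Orbi.Orbifold n M)
    {k : ℕ∞} (hk : 1 ≤ k) (g : O.RiemannianMetric k) (X : O.VectorField 1) :
    IntegrableOn (Orbi.Orbifold.div g X) O.singularSetᶜ g.vol ∧
      ∫ x in O.singularSetᶜ, Orbi.Orbifold.div g X x ∂g.vol = 0 := by
  obtain ⟨t, c, h, hC, hs, hsum⟩ := O.exists_partition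
  have key := fun i => Orbi.Orbifold.integral_mul_div_add_integral_deriv hk g X (hC i) (c i) (hs i)
  have hdiv : Orbi.Orbifold.div g X = fun x => ∑ i ∈ t, h i x * Orbi.Orbifold.div g X x := by
    ext x
    rw [← Finset.sum_mul, hsum, one_mul]
  have hder : ∀ x, ∑ i ∈ t, X.deriv (h i) x = 0 := by
    intro x
    set p := (O.exists_proj_eq x).choose with hp
    have hU := p.1.1.Uhat.isOpen.mem_nhds p.2.2
    change ∑ i ∈ t, fderiv ℝ (Orbi.Orbifold.pullback (h i) p.1.1) p.2 (X.lift p.1 p.2) = 0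
    have h1 : HasFDerivAt (fun z => ∑ i ∈ t, Orbi.Orbifold.pullback (h i) p.1.1 z) _
        (p.2 : Orbi.E n) :=
      HasFDerivAt.fun_sum fun i _ => (((hC i p.1.1 p.1.2).contDiffAt hU).differentiableAt
        one_ne_zero).hasFDerivAt
    have h2 : (fun z => ∑ i ∈ t, Orbi.Orbifold.pullback (h i) p.1.1 z)
        =ᶠ[nhds (p.2 : Orbi.E n)] fun _ => (1 : ℝ) := by
      filter_upwards [hU] with z hz
      simp_rw [Orbi.Orbifold.pullback_coe _ p.1.1 ⟨z, hz⟩]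
      exact hsum _
    have h3 := h1.unique ((hasFDerivAt_const (1 : ℝ) (p.2 : Orbi.E n)).congr_of_eventuallyEq h2)
    simpa using congrArg (fun L => L (X.lift p.1 p.2)) h3
  constructor
  · rw [hdiv]
    exact integrable_finsetSum _ fun i _ => (key i).1
  · have h1 : ∫ x in O.singularSetᶜ, Orbi.Orbifold.div g X x ∂g.vol =
        ∑ i ∈ t, ∫ x in O.singularSetᶜ, h i x * Orbi.Orbifold.div g X x ∂g.vol := by
      conv_lhs => rw [hdiv]
      exact integral_finsetSum _ fun i _ => (key i).1
    have h2 : ∑ i ∈ t, ∫ x in O.singularSetᶜ, X.deriv (h i) x ∂g.vol = 0 := by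
      rw [← integral_finsetSum _ fun i _ => (key i).2.1]
      simp [hder]
    have h3 : ∑ i ∈ t, ((∫ x in O.singularSetᶜ, h i x * Orbi.Orbifold.div g X x ∂g.vol) +
        ∫ x in O.singularSetᶜ, X.deriv (h i) x ∂g.vol) = 0 :=
      Finset.sum_eq_zero fun i _ => (key i).2.2
    rw [Finset.sum_add_distrib, h2, add_zero] at h3
    rw [h1, h3]
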